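/- **Setting.** Let $G$ be a finite directed graph with vertex set $\mathfrak V$, edge set $\mathfrak E\subset\mathfrak V\times\mathfrak V$ and no directed cycles (in particular no loops). Write $s(e),t(e)$ for the starting and terminal vertices of an edge $e$. Let $\mathfrak V_{in}=\{v_1,\dots,v_n\}$ be the set of vertices with no incoming edges, $\mathfrak V_{out}=\{u_1,\dots,u_m\}$ the set of vertices with no outgoing edges, and $N=\#\mathfrak E$. Weights $\lambda:\mathfrak E\to\mathbb R$ are viewed as elements of $\mathbb R^N$; $\|\cdot\|$ is the Euclidean norm; $B^l_r(\mathbf 0)$ is the open ball of radius $r$ in $\mathbb R^l$, with $B^l_\infty(\mathbf 0)=\mathbb R^l$. Let functions $\sigma_v:\mathbb R\to\mathbb R$ be given for the hidden vertices $v\notin\mathfrak V_{in}\cup\mathfrak V_{out}$, and put $\sigma_v=\mathrm{id}$ for $v\in\mathfrak V_{out}$. The network represents the function $F:\mathbb R^n\times\mathbb R^N\to\mathbb R^m$, $F(\mathbf x,\lambda)=(z(u_1),\dots,z(u_m))$, where (forward propagation) $z(v_i)=x_i$ for $v_i\in\mathfrak V_{in}$ and $z(v)=\sigma_v(a(v))$,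 $a(v)=\sum_{t(e)=v}\lambda(e)z(s(e))$, for $v\notin\mathfrak V_{in}$. For $E:\mathbb R^m\times\mathbb R^m\to\mathbb R$ and a function $g$ defined on a set $D\subset\mathbb R^n$ with values in $\mathbb R^m$, a function $\alpha:\mathbb R^N\to\mathbb R$ is an *adequate augmentation* with respect to $E,F,g$ if $\alpha$ is differentiable; for every $r>0$ there is $c_r>0$ with $\|\nabla\alpha(\lambda)-\nabla\alpha(\lambda')\|\le c_r\|\lambda-\lambda'\|$ whenever $\|\lambda\|,\|\lambda'\|\le r$; and for every $r>0$ there is $R_r>0$ with $\lambda^T\nabla_\lambda\big(E(F(\mathbf x,\lambda),g(\mathbf x))+\alpha(\lambda)\big)\ge0$ whenever $\mathbf x\in D$, $\|\mathbf x\|\le r$ and $\|\lambda\|\ge R_r$. **Proposition 3.3.** Fix $0<\rho\le\infty$ and write $f(\mathbf x,\lambda)=E(F(\mathbf x,\lambda),g(\mathbf x))+\alpha(\lambda)$. Assume: 1. The $\sigma_v$ are uniformly $C^2$-bounded: each $\sigma_v$ (for $v$ hidden) is $C^2$, and there is $M>0$ with $|\sigma_v(t)|,|\sigma_v'(t)|,|\sigma_v''(t)|\le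 M$ for all hidden $v$ and all $t\in\mathbb R$. 2. $\mu$ is a (Borel) probability measure on $B^n_\rho(\mathbf 0)$, and $\mathbf x(0),\mathbf x(1),\dots$ are independent random variables with law $\mu$. 3. $g:B^n_\rho(\mathbf 0)\to\mathbb R^m$ is $\mu$-measurable, $K>0$, $\|g(\mathbf x)\|\le K$ for all $\mathbf x\in B^n_\rho(\mathbf 0)$, and $\mathbf y(k)=g(\mathbf x(k))$. 4. $E:\mathbb R^m\times\mathbb R^m\to\mathbb R$ is differentiable; for $\|\mathbf y\|\le K$ the function $E(\cdot,\mathbf y)$ is $C^2$; and for every $r>0$ there is $\Gamma_r>0$ such that, with $H_{\mathbf z}E$ the Hessian matrix of $E$ in $\mathbf z$, $|E(\mathbf z,\mathbf y)|+\|\nabla_{\mathbf z}E(\mathbf z,\mathbf y)\|+\sqrt{\mathrm{Tr}\big((H_{\mathbf z}E(\mathbf z,\mathbf y))^TH_{\mathbf z}E(\mathbf z,\mathbf y)\big)}\le\Gamma_r$ whenever $\|\mathbf z\|<r$ and $\|\mathbf y\|\le K$. 5. $\alpha:\mathbb R^N\to\mathbb R$ is an adequate augmentation with respect to $E,F,g$,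 and $R_0>0$ is such that $\lambda^T\nabla_\lambda f(\mathbf x,\lambda)\ge0$ whenever $\mathbf x\in B^n_\rho(\mathbf 0)$ and $\|\lambda\|\ge R_0$. 6. Only if $\rho=\infty$: for every $r>0$, the functions $f$ and $\nabla_\lambda f$ are bounded on $\mathbb R^n\times B^N_r(\mathbf 0)$, and $\nabla_\lambda f(\mathbf x,\cdot)$ is Lipschitz on $B^N_r(\mathbf 0)$ with a constant independent of $\mathbf x\in\mathbb R^n$. 7. $\eta_k>0$, $\sum_k\eta_k=\infty$, $\sum_k\eta_k^2<\infty$, and $H=\sup_k\eta_k$. 8. $\lambda_0\in\mathbb R^N$ is fixed, $R_1=\max\Big\{\sqrt{\|\lambda_0\|^2+\sum_k\eta_k^2},\sqrt{R_0^2+2HR_0+\sum_k\eta_k^2}\Big\}$, $\Phi=\sup\{\|\nabla_\lambda f(\mathbf x,\lambda)\| : (\mathbf x,\lambda)\in B^n_\rho(\mathbf 0)\times B^N_{R_1}(\mathbf 0)\}$, and $\varphi>0$ satisfies $\varphi\ge\Phi$. For an input $\mathbf x$, a target $\mathbf y$ and weights $\lambda$, backward propagation computes numbers $\delta(v)$,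 $v\in\mathfrak V$, and $D(e)$, $e\in\mathfrak E$, by $\delta(u_j)=\frac{\partial E}{\partial z_j}(F(\mathbf x,\lambda),\mathbf y)$ for $u_j\in\mathfrak V_{out}$, $\delta(v)=\sum_{s(e)=v}\lambda(e)\,\sigma_{t(e)}'(a(t(e)))\,\delta(t(e))$ for $v\notin\mathfrak V_{out}$, and $D(e)=z(s(e))\,\sigma_{t(e)}'(a(t(e)))\,\delta(t(e))$. Define random weights $\lambda_k$ by the augmented back-propagation algorithm $$\lambda_{k+1}(e)=\lambda_k(e)-\frac{\eta_k}{\varphi}\Big(D_k(e)+\frac{\partial\alpha}{\partial\lambda(e)}(\lambda_k)\Big),$$ where $D_k(e)$ is $D(e)$ for $\mathbf x=\mathbf x(k)$, $\mathbf y=\mathbf y(k)$, $\lambda=\lambda_k$. Let $\mathcal E(\lambda)=\int_{B^n_\rho(\mathbf 0)}E(F(\mathbf x,\lambda),g(\mathbf x))\,d\mu(\mathbf x)$ be the mean error. Then $D(e)=\frac{\partial}{\partial\lambda(e)}E(F(\mathbf x,\lambda),\mathbf y)$ for all $\mathbf x,\mathbf y,\lambda,e$ (so the step is $\eta_k/\varphi$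 times $\nabla_\lambda f(\mathbf x(k),\lambda_k)$), $\Phi<\infty$, the integral defining $\mathcal E(\lambda)$ exists for every $\lambda$, $\mathcal E$ is differentiable on $\mathbb R^N$, and - almost surely, $\mathcal E(\lambda_k)+\alpha(\lambda_k)$ converges to a finite number; - almost surely, $\nabla\mathcal E(\lambda_k)+\nabla\alpha(\lambda_k)\to\mathbf 0$; - almost surely, every limit point of $\{\lambda_k\}$ is a stationary point of $\mathcal E+\alpha$. -/

import Mathlib

open scoped ENNReal Topology

open MeasureTheory Filter Classical

/-- A finite directed acyclic graph on the vertex set `V`, without parallel edges: an edge is an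
ordered pair of vertices, and no vertex can be reached from itself along a nonempty sequence of
consecutive edges (so there are neither directed cycles nor loops). -/
structure AcyclicDigraph (V : Type*) where
  /-- The set of edges; `(a, b)` is the edge from `a` to `b`. -/
  edges : Finset (V × V)
  acyclic : ∀ v : V, ¬ Relation.TransGen (fun a b : V => (a, b) ∈ edges) v v

namespace AcyclicDigraph

variable {V : Type*}

/-- The type of edges of `G`. -/
abbrev Edge (G : AcyclicDigraph V) : Type _ := {e : V × V // e ∈ G.edges}

/-- The starting vertex `s(e)`. -/
def src (G : AcyclicDigraph V) (e : G.Edge) : V := e.1.1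

/-- The terminal vertex `t(e)`. -/
def tgt (G : AcyclicDigraph V) (e : G.Edge) : V := e.1.2

/-- `In(v)`: the edges pointing into `v`. -/
noncomputable def incoming (G : AcyclicDigraph V) (v : V) : Finset G.Edge :=
  Finset.univ.filter fun e => G.tgt e = v

/-- `Out(v)`: the edges pointing out of `v`. -/
noncomputable def outgoing (G : AcyclicDigraph V) (v : V) : Finset G.Edge :=
  Finset.univ.filter fun e => G.src e = v

/-- Input vertices: no edge points into `v`. -/
def IsInput (G : AcyclicDigraph V) (v : V) : Prop := G.incoming v = ∅

/-- Output vertices: no edge points out of `v`. -/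
def IsOutput (G : AcyclicDigraph V) (v : V) : Prop := G.outgoing v = ∅

/-- Hidden vertices: neither input nor output. -/
def IsHidden (G : AcyclicDigraph V) (v : V) : Prop := ¬ G.IsInput v ∧ ¬ G.IsOutput v

/-- The type of input vertices. -/
abbrev InVertex (G : AcyclicDigraph V) : Type _ := {v : V // G.IsInput v}

/-- The type of output vertices. -/
abbrev OutVertex (G : AcyclicDigraph V) : Type _ := {v : V // G.IsOutput v}

/-- The space `ℝⁿ` of inputs, with coordinates indexed by the input vertices. -/
abbrev InputSpace [Fintype V] (G : AcyclicDigraph V) : Type _ := EuclideanSpace ℝ G.InVertex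

/-- The space `ℝᵐ` of outputs, with coordinates indexed by the output vertices. -/
abbrev OutputSpace [Fintype V] (G : AcyclicDigraph V) : Type _ := EuclideanSpace ℝ G.OutVertex

/-- The space `ℝᴺ` of weights `λ : 𝔈 → ℝ`, with the Euclidean norm. -/
abbrev WeightSpace (G : AcyclicDigraph V) : Type _ := EuclideanSpace ℝ G.Edge

theorem wellFounded_edge [Fintype V] (G : AcyclicDigraph V) :
    WellFounded fun a b : V => (a, b) ∈ G.edges := by
  have h : WellFounded (Relation.TransGen fun a b : V => (a, b) ∈ G.edges) := by
    have : Std.Irrefl (Relation.TransGen fun a b : V => (a, b) ∈ G.edges) := ⟨G.acyclic⟩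
    exact Finite.wellFounded_of_trans_of_irrefl _
  exact Subrelation.wf (fun hab => Relation.TransGen.single hab) h

theorem wellFounded_edge_swap [Fintype V] (G : AcyclicDigraph V) :
    WellFounded fun a b : V => (b, a) ∈ G.edges := by
  have h : WellFounded (Function.swap (Relation.TransGen fun a b : V => (a, b) ∈ G.edges)) := by
    have : Std.Irrefl (Function.swap (Relation.TransGen fun a b : V => (a, b) ∈ G.edges)) :=
      ⟨G.acyclic⟩
    have : IsTrans V (Function.swap (Relation.TransGen fun a b : V => (a, b) ∈ G.edges)) :=
      ⟨fun _ _ _ h₁ h₂ => Relation.TransGen.trans h₂ h₁⟩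
    exact Finite.wellFounded_of_trans_of_irrefl _
  exact Subrelation.wf (fun {_ _} hab => Relation.TransGen.single hab) h

theorem src_edge_of_mem_incoming (G : AcyclicDigraph V) {v : V} {e : G.Edge}
    (he : e ∈ G.incoming v) : (G.src e, v) ∈ G.edges := by
  have h : G.tgt e = v := by simpa [incoming] using he
  rw [← h]
  exact e.2

theorem tgt_edge_of_mem_outgoing (G : AcyclicDigraph V) {v : V} {e : G.Edge}
    (he : e ∈ G.outgoing v) : (v, G.tgt e) ∈ G.edges := by
  have h : G.src e = v := by simpa [outgoing] using he
  rw [← h]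
  exact e.2

/-- The function applied at a non-input vertex `v` to the weighted sum of its incoming data: the
activation `σ v` at a hidden vertex, and the identity at an output vertex. -/
noncomputable def activation (G : AcyclicDigraph V) (σ : V → ℝ → ℝ) (v : V) : ℝ → ℝ :=
  if G.IsOutput v then id else σ v

variable [Fintype V]

/-- Forward propagation: the value `z(v)` at each vertex, for the input `x` and the weights `lam`.
It is given by the recursion `forward_eq` below. -/
noncomputable def forward (G : AcyclicDigraph V) (σ : V → ℝ → ℝ) (x : G.InputSpace)
    (lam : G.WeightSpace) : V → ℝ :=
  G.wellFounded_edge.fix fun v z =>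
    if h : G.IsInput v then x ⟨v, h⟩
    else G.activation σ v
      (∑ e ∈ (G.incoming v).attach, lam e.1 * z (G.src e.1) (G.src_edge_of_mem_incoming e.2))

/-- The weighted sum of the data coming into the vertex `v`. -/
noncomputable def weightedSum (G : AcyclicDigraph V) (σ : V → ℝ → ℝ) (x : G.InputSpace)
    (lam : G.WeightSpace) (v : V) : ℝ :=
  ∑ e ∈ G.incoming v, lam e * G.forward σ x lam (G.src e)

theorem forward_eq (G : AcyclicDigraph V) (σ : V → ℝ → ℝ) (x : G.InputSpace)
    (lam : G.WeightSpace) (v : V) :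
    G.forward σ x lam v =
      if h : G.IsInput v then x ⟨v, h⟩ else G.activation σ v (G.weightedSum σ x lam v) := by
  unfold weightedSum
  conv_lhs => unfold forward
  rw [WellFounded.fix_eq]
  split_ifs with h
  · rfl
  · rw [← Finset.sum_attach (G.incoming v)]
    rfl

/-- The function `F(x, λ)` represented by the network. -/
noncomputable def network (G : AcyclicDigraph V) (σ : V → ℝ → ℝ) (x : G.InputSpace)
    (lam : G.WeightSpace) : G.OutputSpace :=
  WithLp.toLp 2 fun u => G.forward σ x lam u.1

/-- Backward propagation to the vertices: the quantity written `∂E(F(x, λ), y) / ∂z(v)`, given by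
the recursion `backward_eq` below. -/
noncomputable def backward (G : AcyclicDigraph V) (σ : V → ℝ → ℝ)
    (Err : G.OutputSpace → G.OutputSpace → ℝ) (x : G.InputSpace) (y : G.OutputSpace)
    (lam : G.WeightSpace) : V → ℝ :=
  G.wellFounded_edge_swap.fix fun v δ =>
    if h : G.IsOutput v then gradient (fun z => Err z y) (G.network σ x lam) ⟨v, h⟩
    else ∑ e ∈ (G.outgoing v).attach,
      lam e.1 * deriv (G.activation σ (G.tgt e.1)) (G.weightedSum σ x lam (G.tgt e.1)) *
        δ (G.tgt e.1) (G.tgt_edge_of_mem_outgoing e.2)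

theorem backward_eq (G : AcyclicDigraph V) (σ : V → ℝ → ℝ)
    (Err : G.OutputSpace → G.OutputSpace → ℝ) (x : G.InputSpace) (y : G.OutputSpace)
    (lam : G.WeightSpace) (v : V) :
    G.backward σ Err x y lam v =
      if h : G.IsOutput v then gradient (fun z => Err z y) (G.network σ x lam) ⟨v, h⟩
      else ∑ e ∈ G.outgoing v,
        lam e * deriv (G.activation σ (G.tgt e)) (G.weightedSum σ x lam (G.tgt e)) *
          G.backward σ Err x y lam (G.tgt e) := by
  conv_lhs => unfold backward
  rw [WellFounded.fix_eq]
  split_ifs with h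
  · rfl
  · rw [← Finset.sum_attach (G.outgoing v)]
    rfl

/-- Backward propagation to the edges: the quantity that the algorithm uses as
`∂E(F(x, λ), y) / ∂λ(e)`. -/
noncomputable def backwardEdge (G : AcyclicDigraph V) (σ : V → ℝ → ℝ)
    (Err : G.OutputSpace → G.OutputSpace → ℝ) (x : G.InputSpace) (y : G.OutputSpace)
    (lam : G.WeightSpace) (e : G.Edge) : ℝ :=
  G.forward σ x lam (G.src e) *
    deriv (G.activation σ (G.tgt e)) (G.weightedSum σ x lam (G.tgt e)) *
      G.backward σ Err x y lam (G.tgt e)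

/-- The augmented back-propagation algorithm with inputs `x 0, x 1, …`, targets `y k = g (x k)`,
learning rates `η k`, divisor `φ` and initial weights `lam₀`: the weights `λ_k`, which depend on
`x 0, …, x (k - 1)` only. -/
noncomputable def augmentedBP (G : AcyclicDigraph V) (σ : V → ℝ → ℝ)
    (Err : G.OutputSpace → G.OutputSpace → ℝ) (g : G.InputSpace → G.OutputSpace)
    (α : G.WeightSpace → ℝ) (η : ℕ → ℝ) (φ : ℝ) (lam₀ : G.WeightSpace)
    (x : ℕ → G.InputSpace) : ℕ → G.WeightSpace
  | 0 => lam₀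
  | k + 1 =>
    let lam := augmentedBP G σ Err g α η φ lam₀ x k
    WithLp.toLp 2 fun e =>
      lam e - η k / φ * (G.backwardEdge σ Err (x k) (g (x k)) lam e + gradient α lam e)

/-- The augmented error `E(F(x, λ), g(x)) + α(λ)`. -/
noncomputable def augmentedError (G : AcyclicDigraph V) (σ : V → ℝ → ℝ)
    (Err : G.OutputSpace → G.OutputSpace → ℝ) (g : G.InputSpace → G.OutputSpace)
    (α : G.WeightSpace → ℝ) (x : G.InputSpace) (lam : G.WeightSpace) : ℝ :=
  Err (G.network σ x lam) (g x) + α lam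

/-- `α` is an adequate augmentation with respect to `E`, `F` and a function `g` that is defined on
the set `D` (values of `g` outside `D` are not used). -/
structure IsAdequateAugmentation (G : AcyclicDigraph V) (σ : V → ℝ → ℝ)
    (Err : G.OutputSpace → G.OutputSpace → ℝ) (D : Set G.InputSpace)
    (g : G.InputSpace → G.OutputSpace) (α : G.WeightSpace → ℝ) : Prop where
  differentiable : Differentiable ℝ α
  locallyLipschitz : ∀ r : ℝ, 0 < r → ∃ c : ℝ, 0 < c ∧ ∀ lam lam' : G.WeightSpace,
    ‖lam‖ ≤ r → ‖lam'‖ ≤ r → ‖gradient α lam - gradient α lam'‖ ≤ c * ‖lam - lam'‖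
  radial : ∀ r : ℝ, 0 < r → ∃ R : ℝ, 0 < R ∧ ∀ x ∈ D, ‖x‖ ≤ r → ∀ lam : G.WeightSpace,
    R ≤ ‖lam‖ → 0 ≤ inner ℝ lam (gradient (G.augmentedError σ Err g α x) lam)

/-- The activations of the hidden vertices are uniformly `C²`-bounded. -/
def UniformlyC2Bounded (G : AcyclicDigraph V) (σ : V → ℝ → ℝ) : Prop :=
  ∃ M : ℝ, 0 < M ∧ ∀ v, G.IsHidden v → ContDiff ℝ 2 (σ v) ∧
    ∀ t : ℝ, |σ v t| ≤ M ∧ |deriv (σ v) t| ≤ M ∧ |deriv (deriv (σ v)) t| ≤ M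

/-- The mean error `𝓔(λ) = ∫_D E(F(x, λ), g(x)) dμ(x)`. -/
noncomputable def meanError (G : AcyclicDigraph V) (σ : V → ℝ → ℝ)
    (Err : G.OutputSpace → G.OutputSpace → ℝ) (D : Set G.InputSpace)
    (g : G.InputSpace → G.OutputSpace) (μ : Measure G.InputSpace) (lam : G.WeightSpace) : ℝ :=
  ∫ x in D, Err (G.network σ x lam) (g x) ∂μ

end AcyclicDigraph

/-- The Hessian matrix `(∂²f / ∂zᵢ∂zⱼ)` of a function on a Euclidean space. -/
noncomputable def hessianMatrix {ι : Type*} [Fintype ι] (f : EuclideanSpace ℝ ι → ℝ)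
    (z : EuclideanSpace ℝ ι) : Matrix ι ι ℝ :=
  Matrix.of fun i j => gradient (fun w => gradient f w j) z i

/-- `E(z, y)` is `C²`-bounded with respect to `z` on `B_r × {‖y‖ ≤ K}` for every `r > 0`. -/
def C2BoundedOnBalls {ι κ : Type*} [Fintype ι] [Fintype κ]
    (Err : EuclideanSpace ℝ ι → EuclideanSpace ℝ κ → ℝ) (K : ℝ) : Prop :=
  (∀ y : EuclideanSpace ℝ κ, ‖y‖ ≤ K → ContDiff ℝ 2 fun z => Err z y) ∧
  ∀ r : ℝ, 0 < r → ∃ Γ : ℝ, 0 < Γ ∧ ∀ z : EuclideanSpace ℝ ι, ‖z‖ < r →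
    ∀ y : EuclideanSpace ℝ κ, ‖y‖ ≤ K →
      |Err z y| + ‖gradient (fun w => Err w y) z‖ +
        √(((hessianMatrix (fun w => Err w y) z).transpose *
          hessianMatrix (fun w => Err w y) z).trace) ≤ Γ

/-!
Back-propagation is the adjoint form of the chain rule: expanding `∑ δ(v) dz(v)` once along incoming
and once along outgoing edges leaves `∑ D(e) dλ(e)` on one side and the differential of the error on
the other (`AcyclicDigraph.hasGradientAt_error`). So the algorithm is a stochastic gradient descent
for the augmented mean error `L = 𝓔 + α`, the mean of the random functions `f(x, ·)`.

These functions are bounded with bounded and Lipschitz gradient on balls of weights, uniformly in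
the input (`UniformlyC11OnBalls`): for bounded inputs because the network is `C²` on a compact set,
for unbounded inputs by assumption. Hence one may differentiate under the integral sign, and `L`
inherits the bounds (`UniformlyC11OnBalls.integral`). The radial condition and the normalisation of
the steps by `φ` keep the iterates in the ball of radius `R₁` (`norm_lt_of_radial`), so these
bounds are available along the whole trajectory.

Write the sampled gradient at step `k` as `∇L(λ_k)` plus noise. As `x(k)` is independent of `λ_k`,
the sums `∑ γ_k ⟪∇L(λ_k), noise_k⟫`, with `γ_k = η_k / φ`, form a martingale bounded in `L²`, which
converges almost surely (`ae_tendsto_sum_of_mean_zero`). The rest is pathwise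
(`tendsto_of_perturbed_descent`): by Taylor's formula `L(λ_n)` equals `-∑_{k<n} γ_k ‖∇L(λ_k)‖²` up to
a convergent sequence, and `L` is bounded, so `∑ γ_k ‖∇L(λ_k)‖² < ∞` and `L(λ_n)` converges.
Finally `b_k = ‖∇L(λ_k)‖²` satisfies `|b_{k+1} - b_k| = O(γ_k)`, so `b_k²` has summable increments
and a limit, which must be `0` because `∑ γ_k = ∞` (`tendsto_zero_of_summable_mul`).
-/

/-! ### Smoothness of the network and back-propagation -/

namespace AcyclicDigraph

variable {V : Type*}

theorem mem_incoming (G : AcyclicDigraph V) {v : V} {e : G.Edge} :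
    e ∈ G.incoming v ↔ G.tgt e = v := by
  simp [incoming]

theorem mem_outgoing (G : AcyclicDigraph V) {v : V} {e : G.Edge} :
    e ∈ G.outgoing v ↔ G.src e = v := by
  simp [outgoing]

theorem contDiff_activation {G : AcyclicDigraph V} {σ : V → ℝ → ℝ} (hσ : G.UniformlyC2Bounded σ)
    {v : V} (hv : ¬ G.IsInput v) : ContDiff ℝ 2 (G.activation σ v) := by
  obtain ⟨M, -, hM⟩ := hσ
  unfold activation
  split_ifs with h
  · exact contDiff_id
  · exact (hM v ⟨hv, h⟩).1

variable [Fintype V]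

theorem contDiff_forward {G : AcyclicDigraph V} {σ : V → ℝ → ℝ} (hσ : G.UniformlyC2Bounded σ)
    (v : V) : ContDiff ℝ 2 fun p : G.InputSpace × G.WeightSpace => G.forward σ p.1 p.2 v := by
  induction v using G.wellFounded_edge.induction with
  | _ v ih =>
    by_cases hv : G.IsInput v
    · simp only [forward_eq, hv, dif_pos]
      fun_prop
    · simp only [forward_eq, hv, dif_neg, not_false_eq_true]
      unfold weightedSum
      refine (contDiff_activation hσ hv).comp (ContDiff.sum fun e he => ?_)
      exact ContDiff.mul (by fun_prop) (ih _ (G.src_edge_of_mem_incoming he))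

theorem contDiff_network {G : AcyclicDigraph V} {σ : V → ℝ → ℝ} (hσ : G.UniformlyC2Bounded σ) :
    ContDiff ℝ 2 fun p : G.InputSpace × G.WeightSpace => G.network σ p.1 p.2 :=
  contDiff_euclidean.2 fun u => contDiff_forward hσ u.1

theorem differentiable_forward {G : AcyclicDigraph V} {σ : V → ℝ → ℝ}
    (hσ : G.UniformlyC2Bounded σ) (x : G.InputSpace) (v : V) :
    Differentiable ℝ fun lam => G.forward σ x lam v :=
  ((contDiff_forward hσ v).comp (contDiff_const.prodMk contDiff_id)).differentiable (by norm_num)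

theorem differentiable_network {G : AcyclicDigraph V} {σ : V → ℝ → ℝ}
    (hσ : G.UniformlyC2Bounded σ) (x : G.InputSpace) :
    Differentiable ℝ fun lam => G.network σ x lam :=
  ((contDiff_network hσ).comp (contDiff_const.prodMk contDiff_id)).differentiable (by norm_num)

/-- The chain rule at a single vertex, in the direction `h`: `d a(v) = ∑ (h(e) z(s(e)) +
λ(e) dz(s(e)))` over the incoming edges. -/
theorem fderiv_forward_apply {G : AcyclicDigraph V} {σ : V → ℝ → ℝ}
    (hσ : G.UniformlyC2Bounded σ) (x : G.InputSpace) (lam h : G.WeightSpace) (v : V) :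
    fderiv ℝ (fun l => G.forward σ x l v) lam h =
      if G.IsInput v then 0 else
        deriv (G.activation σ v) (G.weightedSum σ x lam v) *
          ∑ e ∈ G.incoming v, (h e * G.forward σ x lam (G.src e) +
            lam e * fderiv ℝ (fun l => G.forward σ x l (G.src e)) lam h) := by
  split_ifs with hv
  · simp [forward_eq, hv]
  · have hcoord : ∀ e : G.Edge, HasFDerivAt (fun l : G.WeightSpace => l e)
        (EuclideanSpace.proj e : G.WeightSpace →L[ℝ] ℝ) lam := fun e =>
      (EuclideanSpace.proj e : G.WeightSpace →L[ℝ] ℝ).hasFDerivAt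
    have hsum : HasFDerivAt (fun l => G.weightedSum σ x l v) _ lam :=
      HasFDerivAt.fun_sum fun e (_ : e ∈ G.incoming v) =>
        (hcoord e).mul (differentiable_forward hσ x (G.src e) lam).hasFDerivAt
    have hact := ((contDiff_activation hσ hv).differentiable (by norm_num)
      (G.weightedSum σ x lam v)).hasDerivAt
    have := hact.comp_hasFDerivAt lam hsum
    have heq : (fun l => G.forward σ x l v) =
        G.activation σ v ∘ fun l => G.weightedSum σ x l v := by
      funext l
      simp [forward_eq, hv]
    rw [heq, this.fderiv]
    simp only [_root_.smul_apply, smul_eq_mul, _root_.sum_apply, _root_.add_apply]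
    congr 1
    refine Finset.sum_congr rfl fun e _ => ?_
    rw [show (EuclideanSpace.proj e : G.WeightSpace →L[ℝ] ℝ) h = h e from rfl]
    ring

/-- Back-propagation is correct. The quantity `∑ δ(v) dz(v)` over all vertices can be expanded
by the recursion for `dz` (sum over edges by their targets) and by the recursion for `δ` away from
the outputs (sum over edges by their sources); comparing both leaves the output vertices on one
side and `∑ D(e) h(e)` on the other. -/
theorem hasGradientAt_error {G : AcyclicDigraph V} {σ : V → ℝ → ℝ}
    (hσ : G.UniformlyC2Bounded σ) {Err : G.OutputSpace → G.OutputSpace → ℝ}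
    {y : G.OutputSpace} (hErr : Differentiable ℝ fun z => Err z y) (x : G.InputSpace)
    (lam : G.WeightSpace) :
    HasGradientAt (fun l => Err (G.network σ x l) y)
      (WithLp.toLp 2 (G.backwardEdge σ Err x y lam)) lam := by
  have hF := (differentiable_network hσ x lam).hasFDerivAt
  have hcomp := (hErr (G.network σ x lam)).hasFDerivAt.comp lam hF
  rw [hasGradientAt_iff_hasFDerivAt]
  refine hcomp.congr_fderiv ?_
  ext h
  set Z : V → ℝ := fun v => fderiv ℝ (fun l => G.forward σ x l v) lam h with hZ
  set δ : V → ℝ := G.backward σ Err x y lam with hδ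
  set s : V → ℝ := fun v => deriv (G.activation σ v) (G.weightedSum σ x lam v) with hs
  have hFu : ∀ u : G.OutVertex, (fderiv ℝ (fun l => G.network σ x l) lam h) u = Z u.1 := by
    intro u
    have := ((EuclideanSpace.proj u : G.OutputSpace →L[ℝ] ℝ).hasFDerivAt.comp lam hF).fderiv
    have h2 := congrArg (fun f : G.WeightSpace →L[ℝ] ℝ => f h) this
    exact h2.symm
  have hLHS : (fderiv ℝ (fun z => Err z y) (G.network σ x lam))
      (fderiv ℝ (fun l => G.network σ x l) lam h) = ∑ u : G.OutVertex, δ u.1 * Z u.1 := by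
    rw [← inner_gradient_left, PiLp.inner_apply]
    refine Finset.sum_congr rfl fun u _ => ?_
    rw [hFu, hδ, backward_eq, dif_pos u.2]
    simp [mul_comm]
  have hRHS : (InnerProductSpace.toDual ℝ G.WeightSpace)
      (WithLp.toLp 2 (G.backwardEdge σ Err x y lam)) h =
      ∑ e : G.Edge, G.forward σ x lam (G.src e) * s (G.tgt e) * δ (G.tgt e) * h e := by
    rw [InnerProductSpace.toDual_apply_apply, PiLp.inner_apply]
    refine Finset.sum_congr rfl fun e _ => ?_
    simp [backwardEdge, hδ, hs, mul_comm]
  -- both expansions of `∑ δ(v) dz(v)`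
  have hA : ∑ v, δ v * Z v = ∑ e : G.Edge, δ (G.tgt e) * s (G.tgt e) *
      (h e * G.forward σ x lam (G.src e) + lam e * Z (G.src e)) := by
    rw [← Finset.sum_fiberwise Finset.univ G.tgt]
    refine Finset.sum_congr rfl fun v _ => ?_
    have hv := fderiv_forward_apply hσ x lam h v
    change Z v = _ at hv
    rw [hv]
    split_ifs with hin
    · have : (Finset.univ.filter fun e => G.tgt e = v) = ∅ := hin
      rw [this, Finset.sum_empty, mul_zero]
    · rw [← mul_assoc, Finset.mul_sum]
      refine Finset.sum_congr rfl fun e he => ?_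
      rw [G.mem_incoming.1 he]
  have hB : ∑ v, δ v * Z v = ∑ u : G.OutVertex, δ u.1 * Z u.1 +
      ∑ e : G.Edge, lam e * s (G.tgt e) * δ (G.tgt e) * Z (G.src e) := by
    rw [← Finset.sum_fiberwise Finset.univ G.src, ← Finset.sum_filter_add_sum_filter_not
      Finset.univ (fun v => G.IsOutput v)]
    have h1 : ∑ v with G.IsOutput v, δ v * Z v = ∑ u : G.OutVertex, δ u.1 * Z u.1 :=
      Finset.sum_subtype _ (fun v => by simp) fun v => δ v * Z v
    rw [h1]
    congr 1
    rw [Finset.sum_filter]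
    refine Finset.sum_congr rfl fun v _ => ?_
    by_cases hout : G.IsOutput v
    · have : (Finset.univ.filter fun e => G.src e = v) = ∅ := hout
      rw [if_neg (not_not.2 hout), this, Finset.sum_empty]
    · have hd : δ v = ∑ e ∈ G.outgoing v, lam e * s (G.tgt e) * δ (G.tgt e) := by
        rw [hδ, backward_eq, dif_neg hout]
      rw [if_pos hout, hd, Finset.sum_mul]
      refine Finset.sum_congr rfl fun e he => ?_
      rw [G.mem_outgoing.1 he]
  rw [hRHS]
  refine hLHS.trans ?_
  have hAB := hA.symm.trans hB
  rw [← sub_eq_iff_eq_add] at hAB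
  rw [← hAB, ← Finset.sum_sub_distrib]
  exact Finset.sum_congr rfl fun e _ => by ring

end AcyclicDigraph

/-! ### Deterministic analysis of a perturbed gradient descent -/

/-- A nonnegative sequence `b` whose increments are `O(γ k)` and for which `∑ γ k * b k` converges
tends to `0`, if `∑ γ k = ∞` and `∑ γ k ^ 2 < ∞`. -/
theorem tendsto_zero_of_summable_mul {γ b : ℕ → ℝ} {C : ℝ} (hγ : ∀ k, 0 < γ k)
    (hγ_sum : Tendsto (fun n => ∑ k ∈ Finset.range n, γ k) atTop atTop)
    (hγ_sq : Summable fun k => γ k ^ 2) (hb : ∀ k, 0 ≤ b k)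
    (hsum : Summable fun k => γ k * b k) (hinc : ∀ k, |b (k + 1) - b k| ≤ C * γ k) :
    Tendsto b atTop (𝓝 0) := by
  -- the squares `b k ^ 2` have summable increments, so they converge
  have hvar : Summable fun k => 2 * C * (γ k * b k) + C ^ 2 * γ k ^ 2 :=
    (hsum.mul_left _).add (hγ_sq.mul_left _)
  have hcau : CauchySeq fun k => b k ^ 2 := by
    refine cauchySeq_of_dist_le_of_summable _ (fun k => ?_) hvar
    rw [dist_comm, Real.dist_eq]
    have hk := hinc k
    have hC : 0 ≤ C * γ k := (abs_nonneg _).trans hk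
    have h1 : b (k + 1) + b k ≤ 2 * b k + C * γ k := by
      linarith [le_abs_self (b (k + 1) - b k)]
    calc |b (k + 1) ^ 2 - b k ^ 2| = |b (k + 1) - b k| * (b (k + 1) + b k) := by
          rw [sq_sub_sq, abs_mul, abs_of_nonneg (add_nonneg (hb _) (hb _)), mul_comm]
      _ ≤ (C * γ k) * (2 * b k + C * γ k) :=
          mul_le_mul hk h1 (add_nonneg (hb _) (hb _)) hC
      _ = _ := by ring
  obtain ⟨l, hl⟩ := cauchySeq_tendsto_of_complete hcau
  have hsqrt : Tendsto b atTop (𝓝 (√l)) := by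
    have := (Real.continuous_sqrt.tendsto l).comp hl
    refine this.congr fun k => ?_
    simp [Real.sqrt_sq (hb k)]
  rcases (Real.sqrt_nonneg l).eq_or_lt with h0 | h0
  · rwa [← h0] at hsqrt
  -- a positive limit would make `∑ γ k` converge
  exfalso
  have hev : ∀ᶠ k in atTop, √l / 2 < b k := hsqrt.eventually (lt_mem_nhds (by linarith))
  have hsumγ : Summable γ := by
    refine Summable.of_norm_bounded_eventually_nat (hsum.mul_left (2 / √l)) ?_
    filter_upwards [hev] with k hk
    rw [Real.norm_of_nonneg (hγ k).le]
    have : γ k * (√l / 2) ≤ γ k * b k := mul_le_mul_of_nonneg_left hk.le (hγ k).le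
    calc γ k = 2 / √l * (γ k * (√l / 2)) := by field_simp
      _ ≤ _ := by gcongr
  exact not_tendsto_nhds_of_tendsto_atTop hγ_sum _ hsumγ.hasSum.tendsto_sum_nat

section Descent

variable {W : Type*} [NormedAddCommGroup W] [InnerProductSpace ℝ W] [CompleteSpace W]

/-- First-order Taylor estimate for a function with Lipschitz gradient. -/
theorem Convex.abs_sub_sub_inner_le {U : Set W} (hU : Convex ℝ U) {L : W → ℝ} {D : W → W} {c : ℝ}
    (hc : 0 ≤ c) (hL : ∀ w ∈ U, HasGradientAt L (D w) w)
    (hD : ∀ w ∈ U, ∀ w' ∈ U, ‖D w - D w'‖ ≤ c * ‖w - w'‖) {x y : W} (hx : x ∈ U) (hy : y ∈ U) :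
    |L y - L x - inner ℝ (D x) (y - x)| ≤ c * ‖y - x‖ ^ 2 := by
  have hseg : segment ℝ x y ⊆ U := hU.segment_subset hx hy
  have key := (convex_segment x y).norm_image_sub_le_of_norm_hasFDerivWithin_le' (𝕜 := ℝ)
    (f := L) (f' := fun w => InnerProductSpace.toDual ℝ W (D w))
    (φ := InnerProductSpace.toDual ℝ W (D x)) (C := c * ‖y - x‖)
    (fun w hw => (hL w (hseg hw)).hasFDerivAt.hasFDerivWithinAt) (fun w hw => ?_)
    (left_mem_segment ℝ x y) (right_mem_segment ℝ x y)
  · rw [InnerProductSpace.toDual_apply_apply, Real.norm_eq_abs] at key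
    calc _ ≤ _ := key
      _ = _ := by ring
  · rw [← map_sub, LinearIsometryEquiv.norm_map]
    refine (hD w (hseg hw) x hx).trans (mul_le_mul_of_nonneg_left ?_ hc)
    obtain ⟨t, ht, rfl⟩ := segment_eq_image' ℝ x y ▸ hw
    rw [add_sub_cancel_left, norm_smul, Real.norm_of_nonneg ht.1]
    exact mul_le_of_le_one_left (norm_nonneg _) ht.2

/-- A perturbed gradient descent `w (k + 1) = w k - γ k • S k` whose noise `S k - ∇L (w k)` has a
convergent weighted sum in the direction of the gradient: the values of `L` converge and the
gradient tends to zero. -/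
theorem tendsto_of_perturbed_descent {U : Set W} (hU : Convex ℝ U) {L : W → ℝ} {D : W → W}
    {B c C : ℝ} (hc : 0 ≤ c) (hC : 0 ≤ C) (hL : ∀ w ∈ U, HasGradientAt L (D w) w)
    (hD : ∀ w ∈ U, ∀ w' ∈ U, ‖D w - D w'‖ ≤ c * ‖w - w'‖)
    (hLB : ∀ w ∈ U, |L w| ≤ B) (hDC : ∀ w ∈ U, ‖D w‖ ≤ C)
    {γ : ℕ → ℝ} (hγ : ∀ k, 0 < γ k)
    (hγ_sum : Tendsto (fun n => ∑ k ∈ Finset.range n, γ k) atTop atTop)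
    (hγ_sq : Summable fun k => γ k ^ 2) {w S : ℕ → W} (hw : ∀ k, w k ∈ U)
    (hS : ∀ k, ‖S k‖ ≤ C) (hstep : ∀ k, w (k + 1) = w k - γ k • S k)
    (hM : ∃ l : ℝ, Tendsto (fun n => ∑ k ∈ Finset.range n,
      γ k * inner ℝ (D (w k)) (S k - D (w k))) atTop (𝓝 l)) :
    (∃ l : ℝ, Tendsto (fun k => L (w k)) atTop (𝓝 l)) ∧
      Tendsto (fun k => D (w k)) atTop (𝓝 0) := by
  obtain ⟨m, hm⟩ := hM
  have hdist : ∀ k, ‖w (k + 1) - w k‖ ≤ C * γ k := fun k => by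
    rw [hstep, sub_sub_cancel_left, norm_neg, norm_smul, Real.norm_of_nonneg (hγ k).le, mul_comm]
    exact mul_le_mul_of_nonneg_right (hS k) (hγ k).le
  set r : ℕ → ℝ := fun k => L (w (k + 1)) - L (w k) - inner ℝ (D (w k)) (w (k + 1) - w k) with hr
  have hr_sum : Summable r := by
    refine Summable.of_norm_bounded (hγ_sq.mul_left (c * C ^ 2)) fun k => ?_
    refine (hU.abs_sub_sub_inner_le hc hL hD (hw k) (hw (k + 1))).trans ?_
    rw [mul_assoc, ← mul_pow]
    gcongr
    exact hdist k
  have hr_tendsto := hr_sum.hasSum.tendsto_sum_nat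
  have hexp : ∀ n, L (w n) = L (w 0) - ∑ k ∈ Finset.range n, γ k * ‖D (w k)‖ ^ 2
      - ∑ k ∈ Finset.range n, γ k * inner ℝ (D (w k)) (S k - D (w k))
      + ∑ k ∈ Finset.range n, r k := by
    intro n
    induction n with
    | zero => simp
    | succ n ih =>
      have : r n = L (w (n + 1)) - L (w n) + γ n * ‖D (w n)‖ ^ 2 +
          γ n * inner ℝ (D (w n)) (S n - D (w n)) := by
        simp only [hr]
        rw [hstep, sub_sub_cancel_left, inner_neg_right, real_inner_smul_right, inner_sub_right,
          real_inner_self_eq_norm_sq]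
        ring
      simp only [Finset.sum_range_succ, this]
      linarith
  obtain ⟨B₁, hB₁⟩ := hm.bddBelow_range
  obtain ⟨B₂, hB₂⟩ := hr_tendsto.bddAbove_range
  have hsum : Summable fun k => γ k * ‖D (w k)‖ ^ 2 := by
    refine summable_of_sum_range_le (c := 2 * B - B₁ + B₂)
      (fun k => mul_nonneg (hγ k).le (sq_nonneg _)) fun n => ?_
    have h1 := hB₁ ⟨n, rfl⟩
    have h2 := hB₂ ⟨n, rfl⟩
    have h3 := hexp n
    have h4 := neg_le_of_abs_le (hLB _ (hw n))
    have h5 := le_of_abs_le (hLB _ (hw 0))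
    simp only at h1 h2
    linarith
  refine ⟨⟨_, (((tendsto_const_nhds.sub hsum.hasSum.tendsto_sum_nat).sub hm).add
    hr_tendsto).congr fun n => (hexp n).symm⟩, ?_⟩
  have hsq : Tendsto (fun k => ‖D (w k)‖ ^ 2) atTop (𝓝 0) := by
    refine tendsto_zero_of_summable_mul (C := 2 * C * (c * C)) hγ hγ_sum hγ_sq
      (fun k => sq_nonneg _) hsum fun k => ?_
    rw [sq_sub_sq, abs_mul, abs_of_nonneg (add_nonneg (norm_nonneg _) (norm_nonneg _)), mul_assoc]
    refine mul_le_mul ?_ ?_ (abs_nonneg _) (by positivity)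
    · linarith [hDC _ (hw k), hDC _ (hw (k + 1))]
    · refine (abs_norm_sub_norm_le _ _).trans ((hD _ (hw _) _ (hw _)).trans ?_)
      rw [mul_assoc]
      exact mul_le_mul_of_nonneg_left (hdist k) hc
  rw [tendsto_zero_iff_norm_tendsto_zero]
  have := (Real.continuous_sqrt.tendsto 0).comp hsq
  simpa [Function.comp_def, Real.sqrt_sq] using this

end Descent

/-! ### Stochastic gradient descent -/

section Stochastic

variable {Ω 𝒳 W : Type*} {mΩ : MeasurableSpace Ω} [MeasurableSpace 𝒳]

/-- The past of a sequence of random variables: the `n`-th σ-algebra is generated by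
`X 0, …, X (n - 1)`. -/
def pastFiltration (X : ℕ → Ω → 𝒳) (hX : ∀ k, Measurable (X k)) : Filtration ℕ mΩ where
  seq n := ⨆ j ∈ Set.Iio n, MeasurableSpace.comap (X j) inferInstance
  mono' _ _ h := biSup_mono fun _ hj => lt_of_lt_of_le hj h
  le' _ := iSup₂_le fun j _ => (hX j).comap_le

theorem measurable_pastFiltration {X : ℕ → Ω → 𝒳} {hX : ∀ k, Measurable (X k)} {j n : ℕ}
    (hj : j < n) : Measurable[pastFiltration X hX n] (X j) :=
  measurable_iff_comap_le.2
    (le_iSup₂_of_le (f := fun j (_ : j ∈ Set.Iio n) => MeasurableSpace.comap (X j) inferInstance)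
      j hj le_rfl)

variable {P : Measure Ω} [IsProbabilityMeasure P] {μ : Measure 𝒳} [IsProbabilityMeasure μ]
  [MeasurableSpace W]

/-- Conditionally on the past `Z, Y`, the variable `X n` still has law `μ`; so the expectation of
`Z * h (X n) Y` vanishes if `∫ h (x, y) dμ(x) = 0` for all `y`. -/
theorem integral_mul_eq_zero_of_past {X : ℕ → Ω → 𝒳} (hX : ∀ k, Measurable (X k))
    (hindep : ProbabilityTheory.iIndepFun X P) (n : ℕ) (hlaw : P.map (X n) = μ)
    {Z : Ω → ℝ} {Y : Ω → W} (hZ : Measurable[pastFiltration X hX n] Z)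
    (hY : Measurable[pastFiltration X hX n] Y) {h : 𝒳 × W → ℝ} (hh : Measurable h)
    (hh0 : ∀ y, ∫ x, h (x, y) ∂μ = 0) :
    ∫ ω, Z ω * h (X n ω, Y ω) ∂P = 0 := by
  have hle := (pastFiltration X hX).le n
  have hZY : Measurable[pastFiltration X hX n] fun ω => (Z ω, Y ω) := hZ.prodMk hY
  have hind : ProbabilityTheory.IndepFun (fun ω => (Z ω, Y ω)) (X n) P := by
    have h1 := ProbabilityTheory.indep_iSup_of_disjoint (S := Set.Iio n) (T := {n})
      (fun k => (hX k).comap_le) hindep (by simp)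
    rw [iSup_singleton] at h1
    exact ProbabilityTheory.indep_of_indep_of_le_left h1 hZY.comap_le
  have hmZY : Measurable fun ω => (Z ω, Y ω) := hZY.mono hle le_rfl
  have hprod := (ProbabilityTheory.indepFun_iff_map_prod_eq_prod_map_map hmZY.aemeasurable
    (hX n).aemeasurable).1 hind
  rw [hlaw] at hprod
  have : IsProbabilityMeasure (P.map fun ω => (Z ω, Y ω)) :=
    Measure.isProbabilityMeasure_map hmZY.aemeasurable
  set k : (ℝ × W) × 𝒳 → ℝ := fun q => q.1.1 * h (q.2, q.1.2) with hk
  have hkm : Measurable k := by fun_prop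
  have hmap : ∫ ω, Z ω * h (X n ω, Y ω) ∂P = ∫ q, k q ∂(P.map fun ω => ((Z ω, Y ω), X n ω)) :=
    (integral_map (hmZY.prodMk (hX n)).aemeasurable hkm.aestronglyMeasurable).symm
  rw [hmap, hprod]
  by_cases hint : Integrable k ((P.map fun ω => (Z ω, Y ω)).prod μ)
  · rw [integral_prod _ hint]
    simp [hk, integral_const_mul, hh0]
  · exact integral_undef hint

/-- The martingale transform `∑ γ k * h (X k, Y k)` of a bounded kernel `h` that has mean zero in
its first variable converges almost surely if `∑ γ k ^ 2 < ∞`. -/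
theorem ae_tendsto_sum_of_mean_zero {X : ℕ → Ω → 𝒳} (hX : ∀ k, Measurable (X k))
    (hindep : ProbabilityTheory.iIndepFun X P) (hlaw : ∀ k, P.map (X k) = μ)
    {Y : ℕ → Ω → W} (hY : ∀ n, Measurable[pastFiltration X hX n] (Y n)) {h : 𝒳 × W → ℝ}
    (hh : Measurable h) (hh0 : ∀ y, ∫ x, h (x, y) ∂μ = 0) {C : ℝ} (hhC : ∀ q, |h q| ≤ C)
    {γ : ℕ → ℝ} (hγ_sq : Summable fun k => γ k ^ 2) :
    ∀ᵐ ω ∂P, ∃ l : ℝ, Tendsto (fun n => ∑ k ∈ Finset.range n, γ k * h (X k ω, Y k ω))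
      atTop (𝓝 l) := by
  set ℱ := pastFiltration X hX with hℱ
  set M : ℕ → Ω → ℝ := fun n ω => ∑ k ∈ Finset.range n, γ k * h (X k ω, Y k ω) with hM
  have hterm : ∀ k n, k < n → Measurable[ℱ n] fun ω => h (X k ω, Y k ω) := fun k n hkn =>
    hh.comp ((measurable_pastFiltration hkn).prodMk ((hY k).mono (ℱ.mono hkn.le) le_rfl))
  have hMm : ∀ n, Measurable[ℱ n] (M n) := fun n =>
    Finset.measurable_fun_sum _ fun k hk =>
      Measurable.const_mul (hterm k n (Finset.mem_range.1 hk)) _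
  have hMm' : ∀ n, Measurable (M n) := fun n => (hMm n).mono (ℱ.le n) le_rfl
  have hhm : ∀ n, Measurable fun ω => h (X n ω, Y n ω) := fun n =>
    (hterm n (n + 1) n.lt_succ_self).mono (ℱ.le _) le_rfl
  have hbdd : ∀ n, ∃ K, ∀ ω, |M n ω| ≤ K := fun n =>
    ⟨∑ k ∈ Finset.range n, |γ k| * C, fun ω => (Finset.abs_sum_le_sum_abs _ _).trans
      (Finset.sum_le_sum fun k _ => by
        rw [abs_mul]; exact mul_le_mul_of_nonneg_left (hhC _) (abs_nonneg _))⟩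
  have hint_of_bdd : ∀ {f : Ω → ℝ}, Measurable f → (∃ K, ∀ ω, |f ω| ≤ K) → Integrable f P :=
    fun hf ⟨K, hK⟩ => Integrable.of_bound hf.aestronglyMeasurable K (ae_of_all _ hK)
  have hMint : ∀ n, Integrable (M n) P := fun n => hint_of_bdd (hMm' n) (hbdd n)
  have hhint : ∀ n, Integrable (fun ω => h (X n ω, Y n ω)) P := fun n =>
    hint_of_bdd (hhm n) ⟨C, fun ω => hhC _⟩
  have hsucc : ∀ n ω, M (n + 1) ω = M n ω + γ n * h (X n ω, Y n ω) := fun n ω =>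
    Finset.sum_range_succ _ _
  have hmart : Martingale M ℱ P := by
    refine martingale_of_setIntegral_eq_succ (fun n => (hMm n).stronglyMeasurable) hMint
      fun n s hs => ?_
    have hs' : MeasurableSet s := ℱ.le n _ hs
    simp only [hsucc]
    rw [integral_add (hMint n).integrableOn ((hhint n).const_mul _).integrableOn,
      integral_const_mul]
    have hz := integral_mul_eq_zero_of_past hX hindep n (hlaw n)
      (Z := s.indicator fun _ => (1 : ℝ)) (measurable_const.indicator hs) (hY n) hh hh0
    have : ∫ ω in s, h (X n ω, Y n ω) ∂P = 0 := by
      rw [← integral_indicator hs', ← hz]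
      congr 1
      ext ω
      by_cases hω : ω ∈ s <;> simp [hω]
    rw [this, mul_zero, add_zero]
  have hL2 : ∀ n, ∫ ω, M n ω ^ 2 ∂P ≤ C ^ 2 * ∑ k ∈ Finset.range n, γ k ^ 2 := by
    intro n
    induction n with
    | zero => simp [hM]
    | succ n ih =>
      obtain ⟨K, hK⟩ := hbdd n
      have i1 : Integrable (fun ω => M n ω ^ 2) P :=
        hint_of_bdd ((hMm' n).pow_const 2) ⟨K ^ 2, fun ω => by
          rw [abs_pow]; exact pow_le_pow_left₀ (abs_nonneg _) (hK ω) 2⟩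
      have i2 : Integrable (fun ω => M n ω * h (X n ω, Y n ω)) P :=
        hint_of_bdd ((hMm' n).mul (hhm n)) ⟨K * C, fun ω => by
          rw [abs_mul]
          exact mul_le_mul (hK ω) (hhC _) (abs_nonneg _) ((abs_nonneg _).trans (hK ω))⟩
      have hb2 : ∀ ω, |h (X n ω, Y n ω) ^ 2| ≤ C ^ 2 := fun ω => by
        rw [abs_pow]; exact pow_le_pow_left₀ (abs_nonneg _) (hhC _) 2
      have i3 : Integrable (fun ω => h (X n ω, Y n ω) ^ 2) P :=
        hint_of_bdd ((hhm n).pow_const 2) ⟨C ^ 2, hb2⟩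
      have hz := integral_mul_eq_zero_of_past hX hindep n (hlaw n) (hMm n) (hY n) hh hh0
      have hexp : ∀ ω, M (n + 1) ω ^ 2 = M n ω ^ 2 + 2 * γ n * (M n ω * h (X n ω, Y n ω)) +
          γ n ^ 2 * h (X n ω, Y n ω) ^ 2 := fun ω => by rw [hsucc]; ring
      simp only [hexp]
      have i12 : Integrable (fun ω => M n ω ^ 2 + 2 * γ n * (M n ω * h (X n ω, Y n ω))) P :=
        i1.add (i2.const_mul _)
      rw [integral_add i12 (i3.const_mul _), integral_add i1 (i2.const_mul _),
        integral_const_mul, integral_const_mul, hz]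
      have h3 : ∫ ω, h (X n ω, Y n ω) ^ 2 ∂P ≤ C ^ 2 := by
        have := integral_mono i3 (integrable_const (C ^ 2)) fun ω => (le_abs_self _).trans (hb2 ω)
        simpa using this
      rw [Finset.sum_range_succ]
      nlinarith [mul_le_mul_of_nonneg_left h3 (sq_nonneg (γ n))]
  refine hmart.submartingale.exists_ae_tendsto_of_bdd
    (R := (1 + C ^ 2 * ∑' k, γ k ^ 2).toNNReal) fun n => ?_
  rw [eLpNorm_one_eq_lintegral_enorm, ← ofReal_integral_norm_eq_lintegral_enorm (hMint n)]
  refine ENNReal.ofReal_le_ofReal ?_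
  obtain ⟨K, hK⟩ := hbdd n
  have i1 : Integrable (fun ω => M n ω ^ 2) P :=
    hint_of_bdd ((hMm' n).pow_const 2) ⟨K ^ 2, fun ω => by
      rw [abs_pow]; exact pow_le_pow_left₀ (abs_nonneg _) (hK ω) 2⟩
  calc ∫ ω, ‖M n ω‖ ∂P ≤ ∫ ω, (1 + M n ω ^ 2) ∂P := by
        refine integral_mono (hMint n).norm ((integrable_const _).add i1) fun ω => ?_
        simp only [Real.norm_eq_abs]
        nlinarith [sq_nonneg (|M n ω| - 1), sq_abs (M n ω), abs_nonneg (M n ω)]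
    _ = 1 + ∫ ω, M n ω ^ 2 ∂P := by rw [integral_add (integrable_const _) i1]; simp
    _ ≤ 1 + C ^ 2 * ∑' k, γ k ^ 2 := by
        have := hγ_sq.sum_le_tsum (Finset.range n) fun k _ => sq_nonneg (γ k)
        nlinarith [hL2 n, mul_le_mul_of_nonneg_left this (sq_nonneg C)]

variable [NormedAddCommGroup W] [InnerProductSpace ℝ W] [CompleteSpace W]
  [SecondCountableTopology W] [BorelSpace W]

/-- Convergence of stochastic gradient descent with i.i.d. samples, for iterates that almost surely
stay in a convex set `U` on which the objective `L` is bounded with Lipschitz gradient. The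
sampled gradient `S x w` is bounded and has mean `∇L w` on `U`. -/
theorem ae_tendsto_of_stochastic_gradient_descent {U : Set W} (hU : Convex ℝ U) {L : W → ℝ}
    {S : 𝒳 → W → W} {B c C : ℝ} (hc : 0 ≤ c)
    (hS : Measurable fun q : 𝒳 × W => S q.1 q.2) (hSC : ∀ x w, ‖S x w‖ ≤ C)
    (hL : ∀ w ∈ U, HasGradientAt L (∫ x, S x w ∂μ) w)
    (hLip : ∀ w ∈ U, ∀ w' ∈ U, ‖∫ x, S x w ∂μ - ∫ x, S x w' ∂μ‖ ≤ c * ‖w - w'‖)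
    (hLB : ∀ w ∈ U, |L w| ≤ B) {γ : ℕ → ℝ} (hγ : ∀ k, 0 < γ k)
    (hγ_sum : Tendsto (fun n => ∑ k ∈ Finset.range n, γ k) atTop atTop)
    (hγ_sq : Summable fun k => γ k ^ 2) {X : ℕ → Ω → 𝒳} (hX : ∀ k, Measurable (X k))
    (hindep : ProbabilityTheory.iIndepFun X P) (hlaw : ∀ k, P.map (X k) = μ)
    {w : ℕ → Ω → W} {w₀ : W} (hw₀ : ∀ ω, w 0 ω = w₀)
    (hstep : ∀ k ω, w (k + 1) ω = w k ω - γ k • S (X k ω) (w k ω))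
    (hwU : ∀ᵐ ω ∂P, ∀ k, w k ω ∈ U) :
    ∀ᵐ ω ∂P, (∃ l : ℝ, Tendsto (fun k => L (w k ω)) atTop (𝓝 l)) ∧
      Tendsto (fun k => ∫ x, S x (w k ω) ∂μ) atTop (𝓝 0) := by
  set D : W → W := fun w => ∫ x, S x w ∂μ with hD
  have hC : 0 ≤ C := by
    obtain ⟨x⟩ : Nonempty 𝒳 := μ.nonempty_of_neZero
    exact (norm_nonneg _).trans (hSC x w₀)
  have hDC : ∀ y, ‖D y‖ ≤ C := fun y => by
    simpa using norm_integral_le_of_norm_le_const (μ := μ) (ae_of_all _ fun x => hSC x y)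
  have hDm : Measurable D :=
    (StronglyMeasurable.integral_prod_left' (μ := μ) hS.stronglyMeasurable).measurable
  have hw : ∀ n, Measurable[pastFiltration X hX n] (w n) := by
    intro n
    induction n with
    | zero =>
      have : w 0 = fun _ => w₀ := funext hw₀
      rw [this]
      exact measurable_const
    | succ n ih =>
      have : w (n + 1) = fun ω => w n ω - γ n • S (X n ω) (w n ω) := funext (hstep n)
      rw [this]
      have ih' : Measurable[pastFiltration X hX (n + 1)] (w n) :=
        ih.mono ((pastFiltration X hX).mono n.le_succ) le_rfl
      exact ih'.sub (Measurable.const_smul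
        (hS.comp ((measurable_pastFiltration n.lt_succ_self).prodMk ih')) _)
  have hconv := ae_tendsto_sum_of_mean_zero (μ := μ) hX hindep hlaw hw
    (h := fun q => inner ℝ (D q.2) (S q.1 q.2 - D q.2)) (C := C * (C + C)) (γ := γ)
    ((hDm.comp measurable_snd).inner (hS.sub (hDm.comp measurable_snd))) (fun y => ?_)
    (fun q => ?_) hγ_sq
  · filter_upwards [hconv, hwU] with ω hω hωU
    exact tendsto_of_perturbed_descent hU hc hC hL hLip hLB (fun y _ => hDC y) hγ hγ_sum hγ_sq hωU
      (fun k => hSC _ _) (fun k => hstep k ω) hω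
  · have hint : Integrable (fun x => S x y) μ := Integrable.of_bound
      (hS.comp (measurable_id.prodMk measurable_const)).aestronglyMeasurable C
      (ae_of_all _ fun x => hSC x y)
    have hint' : Integrable (fun x => S x y - D y) μ := hint.sub (integrable_const _)
    change ∫ x, inner ℝ (D y) (S x y - D y) ∂μ = 0
    rw [integral_inner hint', integral_sub hint (integrable_const _)]
    simp [hD]
  · exact (abs_real_inner_le_norm _ _).trans (mul_le_mul (hDC _)
      ((norm_sub_le _ _).trans (add_le_add (hSC _ _) (hDC _))) (norm_nonneg _) hC)

end Stochastic

/-! ### Uniform `C¹¹` bounds on balls -/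

section UniformBounds

variable {𝒳 W : Type*} [NormedAddCommGroup W] [InnerProductSpace ℝ W] [CompleteSpace W]

/-- The functions `f x`, `x ∈ s`, are differentiable and, on every ball, bounded with bounded and
Lipschitz gradient, with a common constant for all `x ∈ s`. -/
def UniformlyC11OnBalls (s : Set 𝒳) (f : 𝒳 → W → ℝ) : Prop :=
  (∀ x ∈ s, Differentiable ℝ (f x)) ∧ ∀ r : ℝ, 0 < r → ∃ C : ℝ, ∀ x ∈ s, ∀ w w' : W,
    ‖w‖ < r → ‖w'‖ < r → |f x w| ≤ C ∧ ‖gradient (f x) w‖ ≤ C ∧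
      ‖gradient (f x) w - gradient (f x) w'‖ ≤ C * ‖w - w'‖

theorem UniformlyC11OnBalls.congr_mono {s t : Set 𝒳} {f f' : 𝒳 → W → ℝ}
    (hf : UniformlyC11OnBalls s f) (hts : t ⊆ s) (h : ∀ x ∈ t, f' x = f x) :
    UniformlyC11OnBalls t f' := by
  refine ⟨fun x hx => h x hx ▸ hf.1 x (hts hx), fun r hr => ?_⟩
  obtain ⟨C, hC⟩ := hf.2 r hr
  refine ⟨C, fun x hx => ?_⟩
  rw [h x hx]
  exact hC x (hts hx)

theorem gradient_fun_add {f g : W → ℝ} {w : W} (hf : DifferentiableAt ℝ f w)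
    (hg : DifferentiableAt ℝ g w) :
    gradient (fun v => f v + g v) w = gradient f w + gradient g w := by
  simp only [gradient, fderiv_fun_add hf hg, map_add]

theorem UniformlyC11OnBalls.add {s : Set 𝒳} {f g : 𝒳 → W → ℝ}
    (hf : UniformlyC11OnBalls s f) (hg : UniformlyC11OnBalls s g) :
    UniformlyC11OnBalls s fun x w => f x w + g x w := by
  refine ⟨fun x hx => (hf.1 x hx).add (hg.1 x hx), fun r hr => ?_⟩
  obtain ⟨C, hC⟩ := hf.2 r hr
  obtain ⟨C', hC'⟩ := hg.2 r hr
  refine ⟨C + C', fun x hx w w' hw hw' => ?_⟩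
  obtain ⟨h1, h2, h3⟩ := hC x hx w w' hw hw'
  obtain ⟨h1', h2', h3'⟩ := hC' x hx w w' hw hw'
  rw [gradient_fun_add (hf.1 x hx w) (hg.1 x hx w), gradient_fun_add (hf.1 x hx w') (hg.1 x hx w')]
  refine ⟨(abs_add_le _ _).trans (add_le_add h1 h1'),
    (norm_add_le _ _).trans (add_le_add h2 h2'), ?_⟩
  rw [add_sub_add_comm, add_mul]
  exact (norm_add_le _ _).trans (add_le_add h3 h3')

/-- A single function with locally Lipschitz gradient, viewed as a constant family. -/
theorem uniformlyC11OnBalls_const [FiniteDimensional ℝ W] (s : Set 𝒳) {α : W → ℝ}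
    (hα : Differentiable ℝ α)
    (hLip : ∀ r : ℝ, 0 < r → ∃ c : ℝ, 0 < c ∧ ∀ w w' : W, ‖w‖ ≤ r → ‖w'‖ ≤ r →
      ‖gradient α w - gradient α w'‖ ≤ c * ‖w - w'‖) :
    UniformlyC11OnBalls s fun _ => α := by
  refine ⟨fun _ _ => hα, fun r hr => ?_⟩
  obtain ⟨c, hc, hcL⟩ := hLip r hr
  obtain ⟨B, hB⟩ := (isCompact_closedBall (0 : W) r).exists_bound_of_continuousOn
    hα.continuous.continuousOn
  refine ⟨max c (max B (‖gradient α 0‖ + c * r)), fun _ _ w w' hw hw' => ⟨?_, ?_, ?_⟩⟩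
  · exact (hB w (by simpa using hw.le)).trans (le_max_of_le_right (le_max_left _ _))
  · have h := hcL w 0 hw.le (by simpa using hr.le)
    rw [sub_zero] at h
    refine le_max_of_le_right (le_max_of_le_right ?_)
    calc ‖gradient α w‖ ≤ ‖gradient α 0‖ + ‖gradient α w - gradient α 0‖ := norm_le_insert' _ _
      _ ≤ _ := by gcongr; exact h.trans (by gcongr)
  · exact (hcL w w' hw.le hw'.le).trans
      (mul_le_mul_of_nonneg_right (le_max_left _ _) (norm_nonneg _))

/-- Integrals of a uniformly `C¹¹` family: differentiation under the integral sign, and the bounds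
are inherited. -/
theorem UniformlyC11OnBalls.integral [MeasurableSpace W] [BorelSpace W]
    [SecondCountableTopology W] [MeasurableSpace 𝒳] {μ : Measure 𝒳} [IsProbabilityMeasure μ]
    {s : Set 𝒳} {f : 𝒳 → W → ℝ} (hf : UniformlyC11OnBalls s f) (hs : ∀ᵐ x ∂μ, x ∈ s)
    (hfm : ∀ w, Measurable fun x => f x w)
    (hgm : Measurable fun q : 𝒳 × W => gradient (f q.1) q.2) :
    (∀ w, Integrable (fun x => f x w) μ) ∧
    (∀ w, HasGradientAt (fun w => ∫ x, f x w ∂μ) (∫ x, gradient (f x) w ∂μ) w) ∧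
    ∀ r : ℝ, 0 < r → ∃ C : ℝ, 0 ≤ C ∧ (∀ x ∈ s, ∀ w : W, ‖w‖ < r → ‖gradient (f x) w‖ ≤ C) ∧
      ∀ w w' : W, ‖w‖ < r → ‖w'‖ < r → |∫ x, f x w ∂μ| ≤ C ∧
      ‖∫ x, gradient (f x) w ∂μ - ∫ x, gradient (f x) w' ∂μ‖ ≤ C * ‖w - w'‖ := by
  have hgm' : ∀ w, Measurable fun x => gradient (f x) w := fun w =>
    hgm.comp (measurable_id.prodMk measurable_const)
  have hint : ∀ w, Integrable (fun x => f x w) μ := fun w => by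
    obtain ⟨C, hC⟩ := hf.2 (‖w‖ + 1) (by positivity)
    refine Integrable.of_bound (hfm w).aestronglyMeasurable C ?_
    filter_upwards [hs] with x hx using (hC x hx w w (by simp) (by simp)).1
  have hgint : ∀ w, Integrable (fun x => gradient (f x) w) μ := fun w => by
    obtain ⟨C, hC⟩ := hf.2 (‖w‖ + 1) (by positivity)
    refine Integrable.of_bound (hgm' w).aestronglyMeasurable C ?_
    filter_upwards [hs] with x hx using (hC x hx w w (by simp) (by simp)).2.1
  refine ⟨hint, fun w => ?_, fun r hr => ?_⟩
  · obtain ⟨C, hC⟩ := hf.2 (‖w‖ + 1) (by positivity)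
    have hnhds : Metric.ball (0 : W) (‖w‖ + 1) ∈ 𝓝 w :=
      Metric.isOpen_ball.mem_nhds (by simp)
    have key := hasFDerivAt_integral_of_dominated_of_fderiv_le (𝕜 := ℝ) (μ := μ)
      (F := fun w x => f x w) (x₀ := w) (bound := fun _ => C)
      (F' := fun w x => InnerProductSpace.toDual ℝ W (gradient (f x) w)) hnhds
      (Eventually.of_forall fun w => (hfm w).aestronglyMeasurable) (hint w)
      ((InnerProductSpace.toDual ℝ W).continuous.comp_aestronglyMeasurable
        (hgm' w).aestronglyMeasurable) ?_ (integrable_const _) ?_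
    · rw [hasGradientAt_iff_hasFDerivAt]
      refine key.congr_fderiv ?_
      ext v
      have hdual : Integrable (fun x => InnerProductSpace.toDual ℝ W (gradient (f x) w)) μ := by
        refine Integrable.of_bound
          ((InnerProductSpace.toDual ℝ W).continuous.comp_aestronglyMeasurable
            (hgm' w).aestronglyMeasurable) C ?_
        filter_upwards [hs] with x hx
        rw [LinearIsometryEquiv.norm_map]
        exact (hC x hx w w (by simp) (by simp)).2.1
      rw [ContinuousLinearMap.integral_apply hdual, InnerProductSpace.toDual_apply_apply,
        real_inner_comm, ← integral_inner (hgint w)]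
      exact integral_congr_ae (ae_of_all _ fun x => by
        simp only [InnerProductSpace.toDual_apply_apply]
        exact real_inner_comm _ _)
    · filter_upwards [hs] with x hx v hv
      rw [LinearIsometryEquiv.norm_map]
      exact (hC x hx v v (by simpa using hv) (by simpa using hv)).2.1
    · filter_upwards [hs] with x hx v hv
      exact (hf.1 x hx v).hasGradientAt.hasFDerivAt
  · obtain ⟨C, hC⟩ := hf.2 r hr
    obtain ⟨x₀, hx₀⟩ := hs.exists
    have hC0 : 0 ≤ C := (abs_nonneg _).trans (hC x₀ hx₀ 0 0 (by simpa) (by simpa)).1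
    refine ⟨C, hC0, fun x hx w hw => (hC x hx w w hw hw).2.1, fun w w' hw hw' => ⟨?_, ?_⟩⟩
    · have := norm_integral_le_of_norm_le_const (μ := μ) (f := fun x => f x w) (C := C) (by
        filter_upwards [hs] with x hx using (hC x hx w w hw hw).1)
      simpa using this
    · rw [← integral_sub (hgint w) (hgint w')]
      have := norm_integral_le_of_norm_le_const (μ := μ)
        (f := fun x => gradient (f x) w - gradient (f x) w') (C := C * ‖w - w'‖) (by
        filter_upwards [hs] with x hx using (hC x hx w w' hw hw').2.2)
      simpa using this

end UniformBounds

/-! ### Bounds for the error of the network on bounded inputs -/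

/-- A Frobenius bound on the Hessian makes the gradient Lipschitz. -/
theorem norm_gradient_sub_le_of_hessianMatrix {ι : Type*} [Fintype ι]
    {f : EuclideanSpace ℝ ι → ℝ} (hf : ContDiff ℝ 2 f) {r Γ : ℝ}
    (hH : ∀ z, ‖z‖ < r → √(((hessianMatrix f z).transpose * hessianMatrix f z).trace) ≤ Γ)
    {z z' : EuclideanSpace ℝ ι} (hz : ‖z‖ < r) (hz' : ‖z'‖ < r) :
    ‖gradient f z - gradient f z'‖ ≤ √(Fintype.card ι) * (Γ * ‖z - z'‖) := by
  have hgrad : ContDiff ℝ 1 (gradient f) :=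
    (InnerProductSpace.toDual ℝ (EuclideanSpace ℝ ι)).symm.contDiff.comp
      (hf.fderiv_right (m := 1) (by norm_num))
  have hcoord : ∀ j, Differentiable ℝ fun w => gradient f w j := fun j =>
    (contDiff_euclidean.1 hgrad j).differentiable (by norm_num)
  have hbound : ∀ j, ∀ w ∈ Metric.ball (0 : EuclideanSpace ℝ ι) r,
      ‖fderiv ℝ (fun w => gradient f w j) w‖ ≤ Γ := by
    intro j w hw
    rw [← toDual_gradient, LinearIsometryEquiv.norm_map]
    refine le_trans ?_ (hH w (by simpa using hw))
    rw [EuclideanSpace.norm_eq]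
    refine Real.sqrt_le_sqrt ?_
    simp only [Matrix.trace, Matrix.diag, Matrix.mul_apply, Matrix.transpose_apply]
    rw [Finset.sum_comm]
    refine Finset.sum_le_sum fun i _ => ?_
    have := Finset.single_le_sum (s := Finset.univ)
      (f := fun k => hessianMatrix f w i k * hessianMatrix f w i k)
      (fun k _ => mul_self_nonneg _) (Finset.mem_univ j)
    refine le_trans (le_of_eq ?_) this
    simp [hessianMatrix, pow_two]
  have hcomp : ∀ j, ‖(gradient f z - gradient f z') j‖ ≤ Γ * ‖z - z'‖ := fun j =>
    (convex_ball (0 : EuclideanSpace ℝ ι) r).norm_image_sub_le_of_norm_fderiv_le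
      (fun w _ => hcoord j w) (hbound j) (by simpa using hz') (by simpa using hz)
  rw [EuclideanSpace.norm_eq]
  have h2 : ∑ j, ‖(gradient f z - gradient f z') j‖ ^ 2 ≤
      Fintype.card ι * (Γ * ‖z - z'‖) ^ 2 := by
    refine (Finset.sum_le_sum fun j _ => pow_le_pow_left₀ (norm_nonneg _) (hcomp j) 2).trans ?_
    simp
  rcases isEmpty_or_nonempty ι with h | ⟨⟨j⟩⟩
  · simp
  · refine (Real.sqrt_le_sqrt h2).trans (le_of_eq ?_)
    rw [Real.sqrt_mul (Nat.cast_nonneg _), Real.sqrt_sq ((norm_nonneg _).trans (hcomp j))]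

namespace AcyclicDigraph

variable {V : Type*} [Fintype V]

/-- On bounded inputs the network and its derivative range over compact sets, so the error is
uniformly `C¹¹` in the weights. -/
theorem uniformlyC11OnBalls_error {G : AcyclicDigraph V} {σ : V → ℝ → ℝ}
    (hσ : G.UniformlyC2Bounded σ) {Err : G.OutputSpace → G.OutputSpace → ℝ} {K : ℝ}
    (hErr : C2BoundedOnBalls Err K) {s : Set G.InputSpace} (hs : Bornology.IsBounded s)
    {g : G.InputSpace → G.OutputSpace} (hg : ∀ x ∈ s, ‖g x‖ ≤ K) :
    UniformlyC11OnBalls s fun x lam => Err (G.network σ x lam) (g x) := by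
  have hErr_diff : ∀ x ∈ s, Differentiable ℝ fun z => Err z (g x) := fun x hx =>
    (hErr.1 _ (hg x hx)).differentiable (by norm_num)
  refine ⟨fun x hx => (hErr_diff x hx).comp (differentiable_network hσ x), fun r hr => ?_⟩
  obtain ⟨ρ, hρ⟩ := hs.subset_closedBall 0
  set F : G.InputSpace × G.WeightSpace → G.OutputSpace := fun p => G.network σ p.1 p.2 with hF
  have hFc : ContDiff ℝ 2 F := contDiff_network hσ
  have hJc : ContDiff ℝ 1 (fderiv ℝ F) := hFc.fderiv_right (by norm_num)
  set Q : Set (G.InputSpace × G.WeightSpace) :=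
    Metric.closedBall 0 ρ ×ˢ Metric.closedBall 0 r with hQ
  have hQc : IsCompact Q := (isCompact_closedBall _ _).prod (isCompact_closedBall _ _)
  obtain ⟨a, ha⟩ := hQc.exists_bound_of_continuousOn hFc.continuous.continuousOn
  obtain ⟨b, hb⟩ := hQc.exists_bound_of_continuousOn hJc.continuous.continuousOn
  obtain ⟨cF, hcF⟩ := ((hFc.of_le (by norm_num)).locallyLipschitz.locallyLipschitzOn
    (s := Q)).exists_lipschitzOnWith_of_compact hQc
  obtain ⟨cJ, hcJ⟩ := (hJc.locallyLipschitz.locallyLipschitzOn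
    (s := Q)).exists_lipschitzOnWith_of_compact hQc
  obtain ⟨Γ, hΓ, hΓE⟩ := hErr.2 (max a 0 + 1) (by positivity)
  have hmem : ∀ x ∈ s, ∀ lam : G.WeightSpace, ‖lam‖ < r → (x, lam) ∈ Q := fun x hx lam hl =>
    ⟨hρ hx, by simpa using hl.le⟩
  have hFa : ∀ p ∈ Q, ‖F p‖ < max a 0 + 1 := fun p hp =>
    ((ha p hp).trans (le_max_left _ _)).trans_lt (lt_add_one _)
  have hgradE : ∀ x ∈ s, ∀ z, ‖z‖ < max a 0 + 1 →
      |Err z (g x)| ≤ Γ ∧ ‖gradient (fun w => Err w (g x)) z‖ ≤ Γ ∧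
      √(((hessianMatrix (fun w => Err w (g x)) z).transpose *
          hessianMatrix (fun w => Err w (g x)) z).trace) ≤ Γ := fun x hx z hz => by
    have := hΓE z hz (g x) (hg x hx)
    have h1 := abs_nonneg (Err z (g x))
    have h2 := norm_nonneg (gradient (fun w => Err w (g x)) z)
    have h3 := Real.sqrt_nonneg (((hessianMatrix (fun w => Err w (g x)) z).transpose *
          hessianMatrix (fun w => Err w (g x)) z).trace)
    exact ⟨by linarith, by linarith, by linarith⟩
  -- the chain rule: the derivative in the weights is `A x lam ∘ N x lam`
  set A : G.InputSpace → G.WeightSpace → G.OutputSpace →L[ℝ] ℝ := fun x lam =>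
    fderiv ℝ (fun z => Err z (g x)) (F (x, lam)) with hA
  set N : G.InputSpace → G.WeightSpace → G.WeightSpace →L[ℝ] G.OutputSpace := fun x lam =>
    (fderiv ℝ F (x, lam)).comp (ContinuousLinearMap.inr ℝ _ _) with hN
  have hderiv : ∀ x ∈ s, ∀ lam : G.WeightSpace,
      HasFDerivAt (fun l => Err (G.network σ x l) (g x)) ((A x lam).comp (N x lam)) lam := by
    intro x hx lam
    have h1 : HasFDerivAt F (fderiv ℝ F (x, lam)) (x, lam) :=
      (hFc.differentiable (by norm_num) _).hasFDerivAt
    exact (hErr_diff x hx _).hasFDerivAt.comp lam (h1.comp lam (hasFDerivAt_prodMk_right x lam))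
  have hgrad : ∀ x ∈ s, ∀ lam : G.WeightSpace,
      gradient (fun l => Err (G.network σ x l) (g x)) lam =
        (InnerProductSpace.toDual ℝ G.WeightSpace).symm ((A x lam).comp (N x lam)) :=
    fun x hx lam => by rw [gradient, (hderiv x hx lam).fderiv]
  have hinr : ‖ContinuousLinearMap.inr ℝ G.InputSpace G.WeightSpace‖ ≤ 1 :=
    ContinuousLinearMap.norm_inr_le_one ℝ _ _
  have hAΓ : ∀ x ∈ s, ∀ lam : G.WeightSpace, ‖lam‖ < r → ‖A x lam‖ ≤ Γ := fun x hx lam hl => by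
    have := (hgradE x hx _ (hFa _ (hmem x hx lam hl))).2.1
    rwa [← LinearIsometryEquiv.norm_map (InnerProductSpace.toDual ℝ G.OutputSpace),
      toDual_gradient] at this
  have hNb : ∀ x ∈ s, ∀ lam : G.WeightSpace, ‖lam‖ < r → ‖N x lam‖ ≤ max b 0 :=
    fun x hx lam hl => by
      refine (ContinuousLinearMap.opNorm_comp_le _ _).trans ?_
      refine (mul_le_of_le_one_right (norm_nonneg _) hinr).trans ?_
      exact (hb _ (hmem x hx lam hl)).trans (le_max_left _ _)
  set m : ℝ := √(Fintype.card G.OutVertex) with hm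
  have hprod : ∀ (x : G.InputSpace) (lam lam' : G.WeightSpace),
      ‖(x, lam) - (x, lam')‖ = ‖lam - lam'‖ := fun x lam lam' => by
    simp [Prod.norm_def]
  refine ⟨max Γ (max (Γ * max b 0) (m * (Γ * cF) * max b 0 + Γ * cJ)),
    fun x hx lam lam' hl hl' => ⟨?_, ?_, ?_⟩⟩
  · exact (hgradE x hx _ (hFa _ (hmem x hx lam hl))).1.trans (le_max_left _ _)
  · rw [hgrad x hx, LinearIsometryEquiv.norm_map]
    refine (ContinuousLinearMap.opNorm_comp_le _ _).trans ?_
    refine le_max_of_le_right (le_max_of_le_left ?_)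
    exact mul_le_mul (hAΓ x hx lam hl) (hNb x hx lam hl) (norm_nonneg _) hΓ.le
  · rw [hgrad x hx, hgrad x hx, ← map_sub, LinearIsometryEquiv.norm_map]
    have hsplit : (A x lam).comp (N x lam) - (A x lam').comp (N x lam') =
        (A x lam - A x lam').comp (N x lam) + (A x lam').comp (N x lam - N x lam') := by
      ext v
      simp
    have hA_sub : ‖A x lam - A x lam'‖ ≤ m * (Γ * (cF * ‖lam - lam'‖)) := by
      have h1 := norm_gradient_sub_le_of_hessianMatrix (hErr.1 _ (hg x hx))
        (fun z hz => (hgradE x hx z hz).2.2) (hFa _ (hmem x hx lam hl)) (hFa _ (hmem x hx lam' hl'))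
      rw [← LinearIsometryEquiv.norm_map (InnerProductSpace.toDual ℝ G.OutputSpace), map_sub,
        toDual_gradient, toDual_gradient] at h1
      refine h1.trans ?_
      have h2 := hcF.norm_sub_le (hmem x hx lam hl) (hmem x hx lam' hl')
      rw [hprod] at h2
      gcongr
    have hN_sub : ‖N x lam - N x lam'‖ ≤ cJ * ‖lam - lam'‖ := by
      have h2 := hcJ.norm_sub_le (hmem x hx lam hl) (hmem x hx lam' hl')
      rw [hprod] at h2
      rw [hN]
      simp only [← ContinuousLinearMap.sub_comp]
      exact ((ContinuousLinearMap.opNorm_comp_le _ _).trans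
        (mul_le_of_le_one_right (norm_nonneg _) hinr)).trans h2
    rw [hsplit]
    calc _ ≤ ‖A x lam - A x lam'‖ * ‖N x lam‖ + ‖A x lam'‖ * ‖N x lam - N x lam'‖ :=
          (norm_add_le _ _).trans (add_le_add (ContinuousLinearMap.opNorm_comp_le _ _)
            (ContinuousLinearMap.opNorm_comp_le _ _))
      _ ≤ m * (Γ * (cF * ‖lam - lam'‖)) * max b 0 + Γ * (cJ * ‖lam - lam'‖) := by
          gcongr
          · exact hNb x hx lam hl
          · exact hAΓ x hx lam' hl'
      _ = (m * (Γ * cF) * max b 0 + Γ * cJ) * ‖lam - lam'‖ := by ring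
      _ ≤ _ := by
          gcongr
          exact (le_max_right _ _).trans (le_max_right _ _)

end AcyclicDigraph

/-! ### Confinement of the iterates -/

/-- If the step directions point outwards beyond the radius `R₀` and have norm at most `φ` inside
the radius `R₁`, the iterates never leave the open ball of radius `R₁`: beyond `R₀` a step
increases `‖w‖ ^ 2` by at most `η k ^ 2`, and inside it ends within `R₀ + η k`. -/
theorem norm_lt_of_radial {W : Type*} [NormedAddCommGroup W] [InnerProductSpace ℝ W]
    {η : ℕ → ℝ} (hη : ∀ k, 0 < η k) (hη_sq : Summable fun k => η k ^ 2) {H R₀ R₁ φ : ℝ}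
    (hH : ∀ k, η k ≤ H) (hR₀ : 0 < R₀) (hφ : 0 < φ) {w S : ℕ → W}
    (hR₁ : R₁ = max (√(‖w 0‖ ^ 2 + ∑' k, η k ^ 2)) (√(R₀ ^ 2 + 2 * H * R₀ + ∑' k, η k ^ 2)))
    (hstep : ∀ k, w (k + 1) = w k - (η k / φ) • S k)
    (hS : ∀ k, ‖w k‖ < R₁ → ‖S k‖ ≤ φ) (hrad : ∀ k, R₀ ≤ ‖w k‖ → 0 ≤ inner ℝ (w k) (S k))
    (k : ℕ) : ‖w k‖ < R₁ := by
  set A : ℝ := max (‖w 0‖ ^ 2) (R₀ ^ 2 + 2 * H * R₀) with hA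
  -- the partial sums of the positive series `∑ η k ^ 2` are strictly below its sum
  have hpart : ∀ n, ∑ j ∈ Finset.range n, η j ^ 2 < ∑' j, η j ^ 2 := fun n => by
    have h1 := hη_sq.sum_le_tsum (Finset.range (n + 1)) fun j _ => sq_nonneg (η j)
    rw [Finset.sum_range_succ] at h1
    linarith [pow_pos (hη n) 2]
  have hlt : ∀ n, ‖w n‖ ^ 2 ≤ A + ∑ j ∈ Finset.range n, η j ^ 2 → ‖w n‖ < R₁ := fun n hn => by
    rw [hR₁, lt_max_iff, Real.lt_sqrt (norm_nonneg _), Real.lt_sqrt (norm_nonneg _)]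
    rcases le_total (‖w 0‖ ^ 2) (R₀ ^ 2 + 2 * H * R₀) with h | h
    · right
      rw [hA, max_eq_right h] at hn
      linarith [hpart n]
    · left
      rw [hA, max_eq_left h] at hn
      linarith [hpart n]
  refine hlt k ?_
  induction k with
  | zero => simp [hA]
  | succ k ih =>
    have hSk := hS k (hlt k ih)
    have hlen : ‖(η k / φ) • S k‖ ≤ η k := by
      rw [norm_smul, Real.norm_of_nonneg (div_pos (hη k) hφ).le, div_mul_eq_mul_div,
        div_le_iff₀ hφ]
      exact mul_le_mul_of_nonneg_left hSk (hη k).le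
    rw [hstep, Finset.sum_range_succ]
    rcases le_or_gt R₀ ‖w k‖ with h | h
    · have hin : 0 ≤ inner ℝ (w k) ((η k / φ) • S k) := by
        rw [real_inner_smul_right]
        exact mul_nonneg (div_pos (hη k) hφ).le (hrad k h)
      rw [norm_sub_sq_real]
      have := pow_le_pow_left₀ (norm_nonneg _) hlen 2
      linarith
    · have h1 : ‖w k - (η k / φ) • S k‖ ≤ R₀ + η k :=
        (norm_sub_le _ _).trans (add_le_add h.le hlen)
      have h2 := pow_le_pow_left₀ (norm_nonneg _) h1 2
      have h3 : R₀ ^ 2 + 2 * H * R₀ ≤ A := le_max_right _ _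
      have h4 : 0 ≤ ∑ j ∈ Finset.range k, η j ^ 2 := Finset.sum_nonneg fun j _ => sq_nonneg _
      nlinarith [mul_le_mul_of_nonneg_right (hH k) hR₀.le]

/-! ### Stochastic gradient descent for a confined uniformly `C¹¹` family -/

/-- Stochastic gradient descent for the mean of a uniformly `C¹¹` family whose iterates stay in a
ball. The sampled gradients are truncated outside the ball, where nothing bounds them; this does
not affect the iterates. -/
theorem UniformlyC11OnBalls.ae_tendsto_of_confined {Ω 𝒳 W : Type*} {mΩ : MeasurableSpace Ω}
    [MeasurableSpace 𝒳] [NormedAddCommGroup W] [InnerProductSpace ℝ W] [CompleteSpace W]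
    [SecondCountableTopology W] [MeasurableSpace W] [BorelSpace W]
    {P : Measure Ω} [IsProbabilityMeasure P] {μ : Measure 𝒳} [IsProbabilityMeasure μ]
    {s : Set 𝒳} {f : 𝒳 → W → ℝ} (hf : UniformlyC11OnBalls s f) (hs : ∀ᵐ x ∂μ, x ∈ s)
    (hfm : ∀ w, Measurable fun x => f x w)
    (hgm : Measurable fun q : 𝒳 × W => gradient (f q.1) q.2)
    {γ : ℕ → ℝ} (hγ : ∀ k, 0 < γ k)
    (hγ_sum : Tendsto (fun n => ∑ k ∈ Finset.range n, γ k) atTop atTop)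
    (hγ_sq : Summable fun k => γ k ^ 2) {X : ℕ → Ω → 𝒳}
    (hlaw : ∀ k, ProbabilityTheory.HasLaw (X k) μ P)
    (hindep : ProbabilityTheory.iIndepFun X P) {w₀ : W} {R : ℝ} (hR : 0 < R)
    (hconf : ∀ x : ℕ → 𝒳, (∀ k, x k ∈ s) → ∀ w : ℕ → W, w 0 = w₀ →
      (∀ k, w (k + 1) = w k - γ k • gradient (f (x k)) (w k)) → ∀ k, ‖w k‖ < R) :
    ∀ᵐ ω ∂P, ∀ w : ℕ → W, w 0 = w₀ →
      (∀ k, w (k + 1) = w k - γ k • gradient (f (X k ω)) (w k)) →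
      (∃ l : ℝ, Tendsto (fun k => ∫ x, f x (w k) ∂μ) atTop (𝓝 l)) ∧
        Tendsto (fun k => gradient (fun v => ∫ x, f x v ∂μ) (w k)) atTop (𝓝 0) := by
  obtain ⟨-, hgrad, hball⟩ := hf.integral hs hfm hgm
  obtain ⟨C, hC, hgC, hLC⟩ := hball R hR
  set T : Set (𝒳 × W) := {q | ‖q.2‖ < R ∧ ‖gradient (f q.1) q.2‖ ≤ C} with hT
  have hTm : MeasurableSet T :=
    (measurableSet_lt measurable_snd.norm measurable_const).inter
      (measurableSet_le hgm.norm measurable_const)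
  set S : 𝒳 → W → W := fun x w => T.indicator (fun q => gradient (f q.1) q.2) (x, w) with hSdef
  have hSm : Measurable fun q : 𝒳 × W => S q.1 q.2 := hgm.indicator hTm
  have hS_eq : ∀ x ∈ s, ∀ w : W, ‖w‖ < R → S x w = gradient (f x) w := fun x hx w hw =>
    Set.indicator_of_mem (show (x, w) ∈ T from ⟨hw, hgC x hx w hw⟩) _
  have hSC : ∀ x w, ‖S x w‖ ≤ C := fun x w => by
    by_cases h : (x, w) ∈ T
    · simpa [hSdef, h] using h.2
    · simpa [hSdef, h] using hC
  have hSint : ∀ w : W, ‖w‖ < R → ∫ x, S x w ∂μ = ∫ x, gradient (f x) w ∂μ := fun w hw =>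
    integral_congr_ae (by filter_upwards [hs] with x hx using hS_eq x hx w hw)
  -- measurable versions of the samples
  set X' : ℕ → Ω → 𝒳 := fun k => (hlaw k).aemeasurable.mk (X k) with hX'
  have hX'm : ∀ k, Measurable (X' k) := fun k => (hlaw k).aemeasurable.measurable_mk
  have hXX' : ∀ k, X k =ᵐ[P] X' k := fun k => (hlaw k).aemeasurable.ae_eq_mk
  have hlaw' : ∀ k, P.map (X' k) = μ := fun k => by
    rw [← Measure.map_congr (hXX' k), (hlaw k).map_eq]
  have hindep' : ProbabilityTheory.iIndepFun X' P := hindep.congr hXX'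
  have hXs : ∀ᵐ ω ∂P, ∀ k, X k ω ∈ s := by
    rw [ae_all_iff]
    intro k
    rw [← (hlaw k).map_eq] at hs
    exact ae_of_ae_map (hlaw k).aemeasurable hs
  have hXX'all : ∀ᵐ ω ∂P, ∀ k, X k ω = X' k ω := ae_all_iff.2 hXX'
  -- the iterates of the truncated recursion
  set v : ℕ → Ω → W := fun n => Nat.rec (fun _ => w₀)
    (fun k prev ω => prev ω - γ k • S (X' k ω) (prev ω)) n with hv
  have hvstep : ∀ k ω, v (k + 1) ω = v k ω - γ k • S (X' k ω) (v k ω) := fun _ _ => rfl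
  have hagree : ∀ ω, (∀ k, X k ω ∈ s) → (∀ k, X k ω = X' k ω) → ∀ w : ℕ → W, w 0 = w₀ →
      (∀ k, w (k + 1) = w k - γ k • gradient (f (X k ω)) (w k)) →
      ∀ k, v k ω = w k ∧ ‖w k‖ < R := fun ω h1 h2 w hw0 hw k => by
    have hwR := hconf (fun k => X k ω) h1 w hw0 hw
    refine ⟨?_, hwR k⟩
    induction k with
    | zero => exact hw0.symm
    | succ k ih => rw [hvstep, ih, ← h2 k, hS_eq _ (h1 k) _ (hwR k), hw]
  have hvU : ∀ᵐ ω ∂P, ∀ k, v k ω ∈ Metric.ball (0 : W) R := by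
    filter_upwards [hXs, hXX'all] with ω h1 h2 k
    have := hagree ω h1 h2
      (fun n => Nat.rec w₀ (fun k prev => prev - γ k • gradient (f (X k ω)) prev) n) rfl
      (fun _ => rfl) k
    rw [mem_ball_zero_iff, this.1]
    exact this.2
  have hsgd := ae_tendsto_of_stochastic_gradient_descent (μ := μ) (convex_ball (0 : W) R)
    (L := fun w => ∫ x, f x w ∂μ) (B := C) hC hSm hSC
    (fun w hw => by rw [hSint w (by simpa using hw)]; exact hgrad w)
    (fun w hw w' hw' => by
      rw [hSint w (by simpa using hw), hSint w' (by simpa using hw')]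
      exact (hLC w w' (by simpa using hw) (by simpa using hw')).2)
    (fun w hw => (hLC w w (by simpa using hw) (by simpa using hw)).1)
    hγ hγ_sum hγ_sq hX'm hindep' hlaw' (w := v) (w₀ := w₀) (fun _ => rfl) hvstep hvU
  filter_upwards [hsgd, hXs, hXX'all] with ω hω h1 h2 w hw0 hw
  have hvw := hagree ω h1 h2 w hw0 hw
  refine ⟨?_, ?_⟩
  · obtain ⟨l, hl⟩ := hω.1
    exact ⟨l, hl.congr fun k => by rw [(hvw k).1]⟩
  · refine hω.2.congr fun k => ?_
    rw [(hvw k).1, hSint _ (hvw k).2, (hgrad _).gradient]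

/-! ### The augmented back-propagation algorithm -/

namespace AcyclicDigraph

variable {V : Type*} [Fintype V]

theorem differentiable_error {G : AcyclicDigraph V} {σ : V → ℝ → ℝ}
    (hσ : G.UniformlyC2Bounded σ) {Err : G.OutputSpace → G.OutputSpace → ℝ}
    {y : G.OutputSpace} (hErr : Differentiable ℝ fun z => Err z y) (x : G.InputSpace) :
    Differentiable ℝ fun lam => Err (G.network σ x lam) y :=
  hErr.comp (differentiable_network hσ x)

/-- The step of the algorithm is a gradient step for the augmented error. -/
theorem augmentedBP_succ {G : AcyclicDigraph V} {σ : V → ℝ → ℝ} (hσ : G.UniformlyC2Bounded σ)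
    {Err : G.OutputSpace → G.OutputSpace → ℝ}
    (hErr : ∀ y, Differentiable ℝ fun z => Err z y) {g : G.InputSpace → G.OutputSpace}
    {α : G.WeightSpace → ℝ} (hα : Differentiable ℝ α) (η : ℕ → ℝ) (φ : ℝ) (lam₀ : G.WeightSpace)
    (x : ℕ → G.InputSpace) (k : ℕ) :
    G.augmentedBP σ Err g α η φ lam₀ x (k + 1) = G.augmentedBP σ Err g α η φ lam₀ x k -
      (η k / φ) • gradient (G.augmentedError σ Err g α (x k))
        (G.augmentedBP σ Err g α η φ lam₀ x k) := by
  set lam := G.augmentedBP σ Err g α η φ lam₀ x k with hlam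
  have hgrad : gradient (G.augmentedError σ Err g α (x k)) lam =
      WithLp.toLp 2 (G.backwardEdge σ Err (x k) (g (x k)) lam) + gradient α lam := by
    rw [← (hasGradientAt_error hσ (hErr (g (x k))) (x k) lam).gradient]
    exact gradient_fun_add (differentiable_error hσ (hErr _) _ _) (hα lam)
  rw [hgrad]
  ext e
  simp only [augmentedBP, ← hlam, PiLp.sub_apply, PiLp.smul_apply, PiLp.add_apply, smul_eq_mul]

theorem measurable_augmentedError {G : AcyclicDigraph V} {σ : V → ℝ → ℝ}
    (hσ : G.UniformlyC2Bounded σ) {Err : G.OutputSpace → G.OutputSpace → ℝ}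
    (hErr : Continuous fun p : G.OutputSpace × G.OutputSpace => Err p.1 p.2)
    {g : G.InputSpace → G.OutputSpace} (hg : Measurable g) (α : G.WeightSpace → ℝ)
    (lam : G.WeightSpace) : Measurable fun x => G.augmentedError σ Err g α x lam := by
  have h1 : Measurable fun x => G.network σ x lam :=
    ((contDiff_network hσ).continuous.comp (continuous_id.prodMk continuous_const)).measurable
  exact (hErr.measurable.comp (h1.prodMk hg)).add_const _

/-- The gradient in the weights is jointly measurable: with the target as a further parameter the
error is jointly continuous, so the parametrised derivative is measurable. -/
theorem measurable_gradient_augmentedError {G : AcyclicDigraph V} {σ : V → ℝ → ℝ}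
    (hσ : G.UniformlyC2Bounded σ) {Err : G.OutputSpace → G.OutputSpace → ℝ}
    (hErr : Continuous fun p : G.OutputSpace × G.OutputSpace => Err p.1 p.2)
    {g : G.InputSpace → G.OutputSpace} (hg : Measurable g) {α : G.WeightSpace → ℝ}
    (hα : Continuous α) :
    Measurable fun q : G.InputSpace × G.WeightSpace =>
      gradient (G.augmentedError σ Err g α q.1) q.2 := by
  set h : G.InputSpace × G.OutputSpace → G.WeightSpace → ℝ := fun p lam =>
    Err (G.network σ p.1 lam) p.2 + α lam with hh
  have hcont : Continuous h.uncurry := by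
    have h1 : Continuous fun q : (G.InputSpace × G.OutputSpace) × G.WeightSpace =>
        G.network σ q.1.1 q.2 :=
          (contDiff_network hσ).continuous.comp
            ((continuous_fst.comp continuous_fst).prodMk continuous_snd)
    exact (hErr.comp (h1.prodMk (by fun_prop))).add (hα.comp continuous_snd)
  have hm := measurable_fderiv_with_param ℝ hcont
  exact (InnerProductSpace.toDual ℝ G.WeightSpace).symm.continuous.measurable.comp
    (hm.comp ((measurable_fst.prodMk (hg.comp measurable_fst)).prodMk measurable_snd))

end AcyclicDigraph

/-! ### Convergence of the algorithm -/

theorem proposition3p3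
    {V : Type*} [Fintype V] (G : AcyclicDigraph V)
    -- the activations; only their values at hidden vertices are used
    (σ : V → ℝ → ℝ) (hσ : G.UniformlyC2Bounded σ)
    -- the radius `0 < ρ ≤ ∞` and the law `μ` of the inputs on the open ball `B_ρ(0)`
    (ρ : ℝ≥0∞) (hρ : 0 < ρ)
    (μ : Measure G.InputSpace) [IsProbabilityMeasure μ]
    (hμ : ∀ᵐ x ∂μ, x ∈ Metric.eball (0 : G.InputSpace) ρ)
    -- the i.i.d. inputs
    {Ω : Type*} [MeasurableSpace Ω] (P : Measure Ω) [IsProbabilityMeasure P]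
    (X : ℕ → Ω → G.InputSpace)
    (hX_law : ∀ k, ProbabilityTheory.HasLaw (X k) μ P)
    (hX_indep : ProbabilityTheory.iIndepFun X P)
    -- the bounded target on `B_ρ(0)`
    (g : G.InputSpace → G.OutputSpace) (hg_meas : AEMeasurable g μ)
    (K : ℝ) (hK : 0 < K) (hg : ∀ x ∈ Metric.eball (0 : G.InputSpace) ρ, ‖g x‖ ≤ K)
    -- the error function
    (Err : G.OutputSpace → G.OutputSpace → ℝ)
    (hErr_diff : Differentiable ℝ fun p : G.OutputSpace × G.OutputSpace => Err p.1 p.2)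
    (hErr : C2BoundedOnBalls Err K)
    -- the adequate augmentation
    (α : G.WeightSpace → ℝ)
    (hα : G.IsAdequateAugmentation σ Err (Metric.eball 0 ρ) g α)
    (R₀ : ℝ) (hR₀ : 0 < R₀)
    (hR₀_radial : ∀ x ∈ Metric.eball (0 : G.InputSpace) ρ, ∀ lam : G.WeightSpace, R₀ ≤ ‖lam‖ →
      0 ≤ inner ℝ lam (gradient (G.augmentedError σ Err g α x) lam))
    -- only for unbounded inputs: uniform bounds on balls of weights
    (htop : ρ = ∞ → ∀ r : ℝ, 0 < r → ∃ C : ℝ, ∀ x : G.InputSpace, ∀ lam lam' : G.WeightSpace,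
      ‖lam‖ < r → ‖lam'‖ < r →
        |G.augmentedError σ Err g α x lam| ≤ C ∧
        ‖gradient (G.augmentedError σ Err g α x) lam‖ ≤ C ∧
        ‖gradient (G.augmentedError σ Err g α x) lam -
          gradient (G.augmentedError σ Err g α x) lam'‖ ≤ C * ‖lam - lam'‖)
    -- the learning rates
    (η : ℕ → ℝ) (hη_pos : ∀ k, 0 < η k)
    (hη_sum : Tendsto (fun n => ∑ k ∈ Finset.range n, η k) atTop atTop)
    (hη_sq : Summable fun k => η k ^ 2)
    -- the initial weights and the constants `H`, `R₁`, `Φ`, `φ`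
    (lam₀ : G.WeightSpace) (H R₁ Φ φ : ℝ)
    (hH : H = ⨆ k, η k)
    (hR₁ : R₁ = max (√(‖lam₀‖ ^ 2 + ∑' k, η k ^ 2))
      (√(R₀ ^ 2 + 2 * H * R₀ + ∑' k, η k ^ 2)))
    (hΦ : Φ = sSup {s : ℝ | ∃ x ∈ Metric.eball (0 : G.InputSpace) ρ, ∃ lam : G.WeightSpace,
      ‖lam‖ < R₁ ∧ s = ‖gradient (G.augmentedError σ Err g α x) lam‖})
    (hφ_pos : 0 < φ) (hφ : Φ ≤ φ) :
    -- back-propagation computes the partial derivatives of the error in the weights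
    (∀ (x : G.InputSpace) (y : G.OutputSpace) (lam : G.WeightSpace) (e : G.Edge),
      G.backwardEdge σ Err x y lam e =
        gradient (fun l => Err (G.network σ x l) y) lam e) ∧
    -- the supremum `Φ` is finite
    BddAbove {s : ℝ | ∃ x ∈ Metric.eball (0 : G.InputSpace) ρ, ∃ lam : G.WeightSpace,
      ‖lam‖ < R₁ ∧ s = ‖gradient (G.augmentedError σ Err g α x) lam‖} ∧
    -- the mean error is well defined and differentiable
    (∀ lam : G.WeightSpace,
      IntegrableOn (fun x => Err (G.network σ x lam) (g x)) (Metric.eball 0 ρ) μ) ∧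
    Differentiable ℝ (G.meanError σ Err (Metric.eball 0 ρ) g μ) ∧
    -- the mean augmented error converges almost surely to a finite number
    (∀ᵐ ω ∂P, ∃ c : ℝ, Tendsto (fun k =>
      G.meanError σ Err (Metric.eball 0 ρ) g μ
          (G.augmentedBP σ Err g α η φ lam₀ (fun j => X j ω) k) +
        α (G.augmentedBP σ Err g α η φ lam₀ (fun j => X j ω) k)) atTop (𝓝 c)) ∧
    -- its gradient converges almost surely to zero
    (∀ᵐ ω ∂P, Tendsto (fun k =>
      gradient (G.meanError σ Err (Metric.eball 0 ρ) g μ)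
          (G.augmentedBP σ Err g α η φ lam₀ (fun j => X j ω) k) +
        gradient α (G.augmentedBP σ Err g α η φ lam₀ (fun j => X j ω) k)) atTop (𝓝 0)) ∧
    -- almost surely every limit point is a stationary point
    (∀ᵐ ω ∂P, ∀ p : G.WeightSpace,
      MapClusterPt p atTop (fun k => G.augmentedBP σ Err g α η φ lam₀ (fun j => X j ω) k) →
        gradient (fun lam => G.meanError σ Err (Metric.eball 0 ρ) g μ lam + α lam) p = 0) := by
  have hErr_cont : Continuous fun p : G.OutputSpace × G.OutputSpace => Err p.1 p.2 :=
    hErr_diff.continuous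
  have hErr_y : ∀ y, Differentiable ℝ fun z => Err z y := fun y =>
    hErr_diff.comp (differentiable_id.prodMk (differentiable_const y))
  set D : Set G.InputSpace := Metric.eball 0 ρ with hD
  have hH_le : ∀ k, η k ≤ H := by
    have hbdd : BddAbove (Set.range η) := by
      refine ⟨1 + ∑' k, η k ^ 2, ?_⟩
      rintro _ ⟨k, rfl⟩
      have := hη_sq.le_tsum k fun j _ => sq_nonneg (η j)
      nlinarith [sq_nonneg (η k - 1), hη_pos k]
    exact fun k => hH ▸ le_ciSup hbdd k
  have hR₁_pos : 0 < R₁ := by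
    rw [hR₁]
    refine lt_max_of_lt_right (Real.sqrt_pos.2 ?_)
    have h1 : 0 ≤ ∑' k, η k ^ 2 := tsum_nonneg fun k => sq_nonneg _
    have h2 : 0 ≤ H := (hη_pos 0).le.trans (hH_le 0)
    positivity
  -- the augmented error is uniformly `C¹¹`: by compactness for bounded inputs, by assumption else
  have hf : UniformlyC11OnBalls D (G.augmentedError σ Err g α) := by
    by_cases hρ_top : ρ = ∞
    · exact ⟨fun x _ => (AcyclicDigraph.differentiable_error hσ (hErr_y _) x).add hα.differentiable,
        fun r hr => (htop hρ_top r hr).imp fun C hC x _ => hC x⟩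
    · have hbd : Bornology.IsBounded D := by
        refine (Metric.isBounded_closedBall (x := (0 : G.InputSpace)) (r := ρ.toReal)).subset
          fun x hx => ?_
        rw [Metric.mem_closedBall, dist_edist]
        exact ENNReal.toReal_mono hρ_top (Metric.mem_eball.1 hx).le
      exact (AcyclicDigraph.uniformlyC11OnBalls_error hσ hErr hbd hg).add
        (uniformlyC11OnBalls_const D hα.differentiable hα.locallyLipschitz)
  have hΦ_bdd : BddAbove {s : ℝ | ∃ x ∈ D, ∃ lam : G.WeightSpace,
      ‖lam‖ < R₁ ∧ s = ‖gradient (G.augmentedError σ Err g α x) lam‖} := by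
    obtain ⟨C, hC⟩ := hf.2 R₁ hR₁_pos
    refine ⟨C, ?_⟩
    rintro _ ⟨x, hx, lam, hl, rfl⟩
    exact (hC x hx lam lam hl hl).2.1
  -- replace the target function by a measurable version `g'`
  set g' := hg_meas.mk g with hg'
  have hg'm : Measurable g' := hg_meas.measurable_mk
  set s : Set G.InputSpace := {x | x ∈ D ∧ g x = g' x} with hs_def
  have hs : ∀ᵐ x ∂μ, x ∈ s := by
    filter_upwards [hμ, hg_meas.ae_eq_mk] with x h1 h2 using ⟨h1, h2⟩
  have hf_eq : ∀ x ∈ s, G.augmentedError σ Err g' α x = G.augmentedError σ Err g α x :=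
    fun x hx => by
      funext lam
      simp only [AcyclicDigraph.augmentedError, hx.2]
  have hf' : UniformlyC11OnBalls s (G.augmentedError σ Err g' α) :=
    hf.congr_mono (fun x hx => hx.1) hf_eq
  have hfm := AcyclicDigraph.measurable_augmentedError hσ hErr_cont hg'm α
  have hgm := AcyclicDigraph.measurable_gradient_augmentedError hσ hErr_cont hg'm
    hα.differentiable.continuous
  obtain ⟨hint, hgrad, hball⟩ := hf'.integral hs hfm hgm
  have hrestrict : μ.restrict D = μ := Measure.restrict_eq_self_of_ae_mem hμ
  have hE_ae : ∀ lam, (fun x => G.augmentedError σ Err g' α x lam - α lam) =ᵐ[μ]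
      fun x => Err (G.network σ x lam) (g x) := fun lam => by
    filter_upwards [hs] with x hx
    rw [hf_eq x hx, AcyclicDigraph.augmentedError, add_sub_cancel_right]
  have hE_int : ∀ lam, Integrable (fun x => Err (G.network σ x lam) (g x)) μ := fun lam =>
    ((hint lam).sub (integrable_const _)).congr (hE_ae lam)
  set L : G.WeightSpace → ℝ := fun lam => ∫ x, G.augmentedError σ Err g' α x lam ∂μ with hL
  have hmean : ∀ lam, G.meanError σ Err D g μ lam = L lam - α lam := fun lam => by
    rw [AcyclicDigraph.meanError, hrestrict, ← integral_congr_ae (hE_ae lam),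
      integral_sub (hint lam) (integrable_const _)]
    simp [hL]
  have hL_eq : ∀ lam, G.meanError σ Err D g μ lam + α lam = L lam := fun lam => by
    rw [hmean, sub_add_cancel]
  have hmean_diff : Differentiable ℝ (G.meanError σ Err D g μ) := by
    rw [funext hmean]
    exact fun lam => (hgrad lam).differentiableAt.sub (hα.differentiable lam)
  have hgrad_eq : ∀ lam, gradient (G.meanError σ Err D g μ) lam + gradient α lam =
      gradient L lam := fun lam => by
    rw [← gradient_fun_add (hmean_diff lam) (hα.differentiable lam), funext hL_eq]
  have hL_cont : Continuous (gradient L) := by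
    rw [continuous_iff_continuousAt]
    intro p
    obtain ⟨C, hC, -, hLip⟩ := hball (‖p‖ + 1) (by positivity)
    have hlip : LipschitzOnWith C.toNNReal (gradient L) (Metric.ball 0 (‖p‖ + 1)) :=
      LipschitzOnWith.of_dist_le_mul fun x hx y hy => by
        rw [dist_eq_norm, dist_eq_norm, Real.coe_toNNReal _ hC, (hgrad x).gradient,
          (hgrad y).gradient]
        exact (hLip x y (by simpa using hx) (by simpa using hy)).2
    exact hlip.continuousOn.continuousAt (Metric.isOpen_ball.mem_nhds (by simp))
  -- the iterates stay in the ball of radius `R₁`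
  have hconf : ∀ x : ℕ → G.InputSpace, (∀ k, x k ∈ s) → ∀ w : ℕ → G.WeightSpace, w 0 = lam₀ →
      (∀ k, w (k + 1) = w k - (η k / φ) • gradient (G.augmentedError σ Err g' α (x k)) (w k)) →
      ∀ k, ‖w k‖ < R₁ := by
    intro x hx w hw0 hw
    refine norm_lt_of_radial hη_pos hη_sq hH_le hR₀ hφ_pos (hw0 ▸ hR₁) hw (fun k hk => ?_)
      fun k hk => ?_
    · rw [hf_eq _ (hx k)]
      exact (le_csSup hΦ_bdd ⟨x k, (hx k).1, w k, hk, rfl⟩).trans (hΦ ▸ hφ)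
    · rw [hf_eq _ (hx k)]
      exact hR₀_radial _ (hx k).1 _ hk
  have hsgd := hf'.ae_tendsto_of_confined hs hfm hgm (γ := fun k => η k / φ)
    (fun k => div_pos (hη_pos k) hφ_pos)
    (by simpa only [← Finset.sum_div] using hη_sum.atTop_div_const hφ_pos)
    (by simpa only [div_pow] using hη_sq.div_const (φ ^ 2)) hX_law hX_indep hR₁_pos hconf
  have hXs : ∀ᵐ ω ∂P, ∀ k, X k ω ∈ s := by
    rw [ae_all_iff]
    intro k
    rw [← (hX_law k).map_eq] at hs
    exact ae_of_ae_map (hX_law k).aemeasurable hs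
  have hmain : ∀ᵐ ω ∂P, (∃ c : ℝ, Tendsto (fun k =>
      L (G.augmentedBP σ Err g α η φ lam₀ (fun j => X j ω) k)) atTop (𝓝 c)) ∧
      Tendsto (fun k => gradient L (G.augmentedBP σ Err g α η φ lam₀ (fun j => X j ω) k))
        atTop (𝓝 0) := by
    filter_upwards [hsgd, hXs] with ω hω hωs
    refine hω _ rfl fun k => ?_
    rw [hf_eq _ (hωs k)]
    exact AcyclicDigraph.augmentedBP_succ hσ hErr_y hα.differentiable η φ lam₀ _ k
  refine ⟨fun x y lam e => ?_, hΦ_bdd, fun lam => (hE_int lam).integrableOn, hmean_diff, ?_, ?_, ?_⟩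
  · rw [(AcyclicDigraph.hasGradientAt_error hσ (hErr_y y) x lam).gradient]
  · filter_upwards [hmain] with ω hω
    simpa only [hL_eq] using hω.1
  · filter_upwards [hmain] with ω hω
    simpa only [hgrad_eq] using hω.2
  · filter_upwards [hmain] with ω hω p hp
    have hcl : MapClusterPt (gradient L p) atTop fun k =>
        gradient L (G.augmentedBP σ Err g α η φ lam₀ (fun j => X j ω) k) :=
      hp.continuousAt_comp hL_cont.continuousAt
    rw [funext hL_eq]
    exact eq_of_nhds_neBot (ClusterPt.mono hcl hω.2)
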